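/- Let $T>0$, $s\ge 0$, and let $q\in L^\infty(0,1)$ be real-valued. Let $\mathcal L=-\frac{d^2}{dx^2}+q$ on $L^2(0,1)=L^2((0,1);\mathbb C)$ with Dirichlet boundary conditions, with eigenvalues $\lambda_k$ and a corresponding orthonormal basis of eigenfunctions $\phi_k$, $k\ge1$, and assume that all $\lambda_k$ are positive. For $r\ge 0$ let $\mathcal L^r f=\sum_k\lambda_k^r\langle f,\phi_k\rangle\phi_k$ on the set of all $f\in L^2(0,1)$ for which the series converges in $L^2(0,1)$, and let $W^s_{\mathcal L}$ be the domain of $\mathcal L^{s/2}$ with the norm $\|f\|_{W^s_{\mathcal L}}=\|\mathcal L^{s/2}f\|_{L^2}$. For a normed space $X$, a net $(f_\varepsilon)_{\varepsilon\in(0,1]}$ in $X$ is called $X$-moderate if there are $N\in\mathbb N_0$ and $C>0$ with $\|f_\varepsilon\|_X\le C\varepsilon^{-N}$ for all $\varepsilon\in(0,1]$. A net of functions on $(0,1)$ is a regularisation of a distribution $A\in\mathcal D'(0,1)$ if it converges to $A$ in the sense of distributions as $\varepsilon\to0^+$. A net $(u_\varepsilon)_{\varepsilon\in(0,1]}$ in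 $C([0,T];W^s_{\mathcal L})\cap C^1([0,T];L^2(0,1))$ is uniformly $s$-moderate if there are $N\in\mathbb N_0$ and $C>0$ with $$\sup_{t\in[0,T]}\Big(\|u_\varepsilon(t)\|_{L^2}+\|\mathcal L^{s/2}u_\varepsilon(t)\|_{L^2}+\|\partial_tu_\varepsilon(t)\|_{L^2}\Big)\le C\varepsilon^{-N}\qquad\text{for all }\varepsilon\in(0,1].$$ **Theorem (Existence).** Let $a,b,u_0,u_1\in\mathcal D'(0,1)$ with $a,b$ non-negative. Let $(a_\varepsilon)$ and $(b_\varepsilon)$ be non-negative $L^\infty(0,1)$-moderate regularisations of $a$ and $b$, let $(u_{0,\varepsilon})$ be a $W^s_{\mathcal L}$-moderate regularisation of $u_0$, and let $(u_{1,\varepsilon})$ be an $L^2(0,1)$-moderate regularisation of $u_1$. Then there is a uniformly $s$-moderate net $(u_\varepsilon)_{\varepsilon\in(0,1]}$ in $C([0,T];W^s_{\mathcal L})\cap C^1([0,T];L^2(0,1))$ such that, for every $\varepsilon\in(0,1]$, $u_\varepsilon$ solves $$\begin{cases}\partial_t^2u_\varepsilon+\mathcal L^su_\varepsilon+a_\varepsilon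 u_\varepsilon+b_\varepsilon\,\partial_tu_\varepsilon=0 & \text{on }[0,T]\times(0,1),\\ u_\varepsilon(0,\cdot)=u_{0,\varepsilon},\quad \partial_tu_\varepsilon(0,\cdot)=u_{1,\varepsilon},\\ u_\varepsilon(t,0)=u_\varepsilon(t,1)=0,& t\in[0,T].\end{cases}$$ That is, the problem $$u_{tt}+\mathcal L^su+a\,u+b\,u_t=0,\qquad u(0,\cdot)=u_0,\quad u_t(0,\cdot)=u_1,\qquad u(t,0)=u(t,1)=0$$ has a very weak solution. Here the equation is understood in the dual of $W^s_{\mathcal L}$: for every $f\in W^s_{\mathcal L}$ the function $t\mapsto\langle\partial_tu_\varepsilon(t),f\rangle$ is differentiable on $[0,T]$ with derivative $-\langle\mathcal L^{s/2}u_\varepsilon(t),\mathcal L^{s/2}f\rangle-\langle a_\varepsilon u_\varepsilon(t)+b_\varepsilon\partial_tu_\varepsilon(t),f\rangle$. The Dirichlet conditions are those built into $\mathcal L$; if $s>\frac12$ they also hold pointwise, for the representative of $u_\varepsilon(t)$ that is continuous on $[0,1]$ (for $s\le\frac12$ elements of $W^s_{\mathcal L}$ have no boundary values in general). -/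

import Mathlib

open MeasureTheory Set Filter Topology
open scoped ENNReal Distributions

noncomputable section

namespace SturmLiouville

/-- The open unit interval as an open subset of `ℝ`. -/
def unitOpen : TopologicalSpace.Opens ℝ := ⟨Ioo 0 1, isOpen_Ioo⟩

/-- Lebesgue measure on `(0,1)`. -/
abbrev mu : Measure ℝ := volume.restrict (Ioo (0 : ℝ) 1)

/-- The complex Hilbert space `L²(0,1)`. -/
abbrev L2 : Type := Lp ℂ 2 mu

/-- The space of real functions `L^∞(0,1)`. -/
abbrev LInf : Type := Lp ℝ ∞ mu

/-! ### The Sturm-Liouville operator and its powers -/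

/-- `f ∈ Dom(𝓛)` and `𝓛 f = g`, where `𝓛 = -d²/dx² + q` with Dirichlet conditions on `(0,1)`:
`f` has a `C¹` representative `F` on `[0,1]` with `F(0) = F(1) = 0`, whose derivative `D` is
absolutely continuous with `D' = q F - g` almost everywhere (written as an integral). -/
def IsDirichletSL (q : ℝ → ℝ) (f g : L2) : Prop :=
  ∃ F D : ℝ → ℂ, f =ᵐ[mu] F ∧
    (∀ x ∈ Icc (0 : ℝ) 1, HasDerivWithinAt F (D x) (Icc 0 1) x) ∧
    (∀ x ∈ Icc (0 : ℝ) 1, D x = D 0 + ∫ t in (0 : ℝ)..x, ((q t : ℂ) * F t - g t)) ∧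
    F 0 = 0 ∧ F 1 = 0

/-- `lam` is a Dirichlet eigenvalue of `𝓛 = -d²/dx² + q` with eigenfunction `phi`
(the operator is symmetric, so that all its eigenvalues are real). -/
def IsEigenpair (q : ℝ → ℝ) (lam : ℝ) (phi : L2) : Prop :=
  phi ≠ 0 ∧ IsDirichletSL q phi ((lam : ℂ) • phi)

/-- `f ∈ Dom(𝓛^r)` and `𝓛^r f = g` in `L²(0,1)`. The eigenfunctions `φ_k` of `𝓛` are an orthogonal
basis of `L²(0,1)`, so that an element of `L²(0,1)` is determined by its coefficients; `𝓛^r` is the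
operator that multiplies the coefficient along an eigenfunction with eigenvalue `λ` by `λ^r`, on
its maximal domain. It is used for potentials with positive eigenvalues only. -/
def IsFracPow (q : ℝ → ℝ) (r : ℝ) (f g : L2) : Prop :=
  ∀ (lam : ℝ) (phi : L2), IsEigenpair q lam phi →
    inner ℂ phi g = ((lam ^ r : ℝ) : ℂ) * inner ℂ phi f

/-! ### Moderate nets and regularisations

A net is a family indexed by `ε`, of which only the members with `ε ∈ (0,1]` matter. -/

/-- `‖f_ε‖ ≲ ε^{-N}` for some `N`, for a net of norms. -/
def IsModerate (n : ℝ → ℝ) : Prop :=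
  ∃ (N : ℕ) (C : ℝ), 0 < C ∧ ∀ ε ∈ Ioc (0 : ℝ) 1, n ε ≤ C * (ε ^ N)⁻¹

/-- The net `f` consists of elements of `W^s_𝓛(0,1)` and is `W^s_𝓛`-moderate, with respect to the
norm `‖f‖_{W^s_𝓛} = ‖𝓛^{s/2} f‖_{L²}`. -/
def IsSobolevModerate (q : ℝ → ℝ) (s : ℝ) (f : ℝ → L2) : Prop :=
  ∃ g : ℝ → L2, (∀ ε ∈ Ioc (0 : ℝ) 1, IsFracPow q (s / 2) (f ε) (g ε)) ∧
    IsModerate (fun ε => ‖g ε‖)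

/-- The net of functions `f` on `(0,1)` is a regularisation of the distribution `A` on `(0,1)`:
`f_ε → A` in the sense of distributions as `ε → 0⁺`. -/
def IsRegularisation {F : Type} [NormedAddCommGroup F] [NormedSpace ℝ F]
    (f : ℝ → ℝ → F) (A : 𝓓'(unitOpen, F)) : Prop :=
  ∀ φ : 𝓓(unitOpen, ℝ), Tendsto (fun ε => ∫ x, φ x • f ε x ∂mu) (𝓝[>] 0) (𝓝 (A φ))

/-- A real distribution is non-negative if it is so on non-negative test functions. -/
def IsNonnegDistribution (A : 𝓓'(unitOpen, ℝ)) : Prop :=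
  ∀ φ : 𝓓(unitOpen, ℝ), (∀ x, 0 ≤ φ x) → 0 ≤ A φ

/-- `aE`, `bE` are non-negative `L^∞`-moderate regularisations of `a`, `b`; `u0E` is a
`W^s_𝓛`-moderate regularisation of `u0`, and `u1E` an `L²`-moderate regularisation of `u1`. -/
structure ModerateRegularisations (q : ℝ → ℝ) (s : ℝ) (a b : 𝓓'(unitOpen, ℝ))
    (u0 u1 : 𝓓'(unitOpen, ℂ)) (aE bE : ℝ → LInf) (u0E u1E : ℝ → L2) : Prop where
  a_reg : IsRegularisation (fun ε => ⇑(aE ε)) a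
  a_nonneg : ∀ ε ∈ Ioc (0 : ℝ) 1, 0 ≤ aE ε
  a_moderate : IsModerate (fun ε => ‖aE ε‖)
  b_reg : IsRegularisation (fun ε => ⇑(bE ε)) b
  b_nonneg : ∀ ε ∈ Ioc (0 : ℝ) 1, 0 ≤ bE ε
  b_moderate : IsModerate (fun ε => ‖bE ε‖)
  u0_reg : IsRegularisation (fun ε => ⇑(u0E ε)) u0
  u0_moderate : IsSobolevModerate q s u0E
  u1_reg : IsRegularisation (fun ε => ⇑(u1E ε)) u1
  u1_moderate : IsModerate (fun ε => ‖u1E ε‖)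

/-! ### Solutions -/

/-- `u ∈ C([0,T]; W^s_𝓛(0,1)) ∩ C¹([0,T]; L²(0,1))`, with `∂_t u = v` and `𝓛^{s/2} u = w`. -/
structure IsInSolutionSpace (T : ℝ) (q : ℝ → ℝ) (s : ℝ) (u v w : ℝ → L2) : Prop where
  deriv : ∀ t ∈ Icc 0 T, HasDerivWithinAt u (v t) (Icc 0 T) t
  deriv_cont : ContinuousOn v (Icc 0 T)
  frac : ∀ t ∈ Icc 0 T, IsFracPow q (s / 2) (u t) (w t)
  frac_cont : ContinuousOn w (Icc 0 T)

/-- `f` has a representative that is continuous on `[0,1]` and vanishes at `0` and `1`. -/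
def VanishesAtEndpoints (f : L2) : Prop :=
  ∃ F : ℝ → ℂ, ContinuousOn F (Icc 0 1) ∧ f =ᵐ[mu] F ∧ F 0 = 0 ∧ F 1 = 0

/-- `u ∈ C([0,T]; W^s_𝓛) ∩ C¹([0,T]; L²)` solves
`u_tt + 𝓛^s u + a u + b u_t = 0`, `u(0) = u0`, `u_t(0) = u1`, `u(t,0) = u(t,1) = 0`.
The equation holds for every `t ∈ [0,T]` in the dual of `W^s_𝓛`, where
`⟨f, 𝓛^s u⟩ = ⟨𝓛^{s/2} f, 𝓛^{s/2} u⟩`. The Dirichlet conditions are those of the operator `𝓛`,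
and hold pointwise if `s > 1/2`; elements of `W^s_𝓛` have no boundary values if `s ≤ 1/2`. -/
def IsSolution (T : ℝ) (q : ℝ → ℝ) (s : ℝ) (a b : LInf) (u0 u1 : L2) (u : ℝ → L2) : Prop :=
  ∃ v w : ℝ → L2, IsInSolutionSpace T q s u v w ∧
    (∀ f g : L2, IsFracPow q (s / 2) f g → ∀ t ∈ Icc 0 T,
      HasDerivWithinAt (fun τ => inner ℂ f (v τ))
        (-(inner ℂ g (w t) + inner ℂ f (a • u t : L2) + inner ℂ f (b • v t : L2)))
        (Icc 0 T) t) ∧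
    u 0 = u0 ∧ v 0 = u1 ∧
    (1 / 2 < s → ∀ t ∈ Icc 0 T, VanishesAtEndpoints (u t))

/-- The net `u` lies in `C([0,T]; W^s_𝓛) ∩ C¹([0,T]; L²)` and is uniformly `s`-moderate:
`sup_{t ∈ [0,T]} (‖u_ε(t)‖ + ‖𝓛^{s/2} u_ε(t)‖ + ‖∂_t u_ε(t)‖) ≲ ε^{-N}` for some `N`. -/
def IsUniformlyModerate (T : ℝ) (q : ℝ → ℝ) (s : ℝ) (u : ℝ → ℝ → L2) : Prop :=
  ∃ v w : ℝ → ℝ → L2,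
    (∀ ε ∈ Ioc (0 : ℝ) 1, IsInSolutionSpace T q s (u ε) (v ε) (w ε)) ∧
    ∃ (N : ℕ) (C : ℝ), 0 < C ∧ ∀ ε ∈ Ioc (0 : ℝ) 1, ∀ t ∈ Icc 0 T,
      ‖u ε t‖ + ‖w ε t‖ + ‖v ε t‖ ≤ C * (ε ^ N)⁻¹

/-- The net `u` solves, for every `ε ∈ (0,1]`, the problem with coefficients and data
`aE ε`, `bE ε`, `u0E ε`, `u1E ε`, and is uniformly `s`-moderate. -/
def IsModerateSolutionNet (T : ℝ) (q : ℝ → ℝ) (s : ℝ) (aE bE : ℝ → LInf) (u0E u1E : ℝ → L2)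
    (u : ℝ → ℝ → L2) : Prop :=
  (∀ ε ∈ Ioc (0 : ℝ) 1, IsSolution T q s (aE ε) (bE ε) (u0E ε) (u1E ε) (u ε)) ∧
    IsUniformlyModerate T q s u

/-- The net `u` is a very weak solution of the problem with coefficients `a`, `b` and data
`u0`, `u1`. -/
def IsVeryWeakSolution (T : ℝ) (q : ℝ → ℝ) (s : ℝ) (a b : 𝓓'(unitOpen, ℝ))
    (u0 u1 : 𝓓'(unitOpen, ℂ)) (u : ℝ → ℝ → L2) : Prop :=
  ∃ (aE bE : ℝ → LInf) (u0E u1E : ℝ → L2),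
    ModerateRegularisations q s a b u0 u1 aE bE u0E u1E ∧
    IsModerateSolutionNet T q s aE bE u0E u1E u

end SturmLiouville

end

/-!
On `(0,1)` let `J` be integration from `0` on the functions of mean zero, a compact operator of
`L²(0,1)`. The Dirichlet problem `-f'' + q f = g` reads `f = J J* (g - q f)`, because `J*` produces
precisely the derivatives of the functions vanishing at both endpoints. Hence `𝓛` has an injective
positive compact resolvent, whose eigenvectors are a Hilbert basis diagonalising `𝓛`, with finitely
many eigenvalues below any bound; if all are positive, they are bounded below by some `δ > 0`.

With `Ω = 𝓛 ^ (s / 2)`, the pair `(Ω u, ∂ₜ u)` evolves under the unitary group of the free wave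
equation, perturbed by the bounded operator `(w, v) ↦ (0, -a Ω⁻¹ w - b v)`. In the interaction
picture this is an ordinary differential equation with bounded coefficients. The energy
`‖Ω u‖² + ‖∂ₜ u‖² + ⟨u, a u⟩` does not increase when `a, b ≥ 0`, so the solution is bounded by a
polynomial in the norms of `a` and of the data, with constants independent of `ε`.

For `s > 1/2` the boundary values come from Agmon's inequality `‖F‖∞² ≤ 2 ‖F‖ ‖F'‖`: a combination
of eigenfunctions with eigenvalues at most `Λ` has sup norm `O(Λ ^ (1 / 4))` relative to its `L²`
norm, so the dyadic blocks of the eigenfunction expansion of an element of `W^s` are uniformly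
summable.
-/

noncomputable section

namespace SturmLiouville

open scoped NNReal InnerProductSpace

section LipschitzODE

variable {E : Type*} [NormedAddCommGroup E] [NormedSpace ℝ E] {M : ℝ → E → E} {T : ℝ}

/-- The Picard map `z ↦ z₀ + ∫₀ᵗ M(τ, z(τ)) dτ` on `[0,T]`, conjugated by the weight `exp (κ t)`:
it acts on the curves `Y` with `z(t) = exp (κ t) Y(t)`. For `κ` larger than the Lipschitz constant
of `M` it is a contraction, whatever `T` is. -/
def weightedPicard (hM : Continuous ↿M) (hT : 0 ≤ T) (κ : ℝ) (z₀ : E) (Y : C(Icc (0 : ℝ) T, E)) :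
    C(Icc (0 : ℝ) T, E) where
  toFun t :=
    Real.exp (-(κ * t)) • ODE.picard M 0 z₀ (fun τ => Real.exp (κ * τ) • IccExtend hT Y τ) t
  continuous_toFun := by
    have hcont : Continuous fun τ => M τ (Real.exp (κ * τ) • IccExtend hT Y τ) :=
      hM.comp (continuous_id.prodMk (Continuous.smul (by fun_prop) Y.continuous.Icc_extend'))
    have := intervalIntegral.continuous_primitive (μ := volume)
      (fun a b => hcont.intervalIntegrable a b) 0
    simp only [ODE.picard]
    fun_prop

theorem exp_neg_mul_integral_exp_le {κ : ℝ} (hκ : 0 < κ) (t : ℝ) :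
    Real.exp (-(κ * t)) * ∫ τ in (0 : ℝ)..t, Real.exp (κ * τ) ≤ κ⁻¹ := by
  have hint : ∫ τ in (0 : ℝ)..t, Real.exp (κ * τ) = κ⁻¹ * (Real.exp (κ * t) - 1) := by
    simp [intervalIntegral.integral_comp_mul_left Real.exp hκ.ne']
  calc Real.exp (-(κ * t)) * ∫ τ in (0 : ℝ)..t, Real.exp (κ * τ)
      = κ⁻¹ * (1 - Real.exp (-(κ * t))) := by rw [hint, Real.exp_neg]; field_simp
    _ ≤ κ⁻¹ := mul_le_of_le_one_right (by positivity) (by linarith [Real.exp_pos (-(κ * t))])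

theorem lipschitzWith_weightedPicard (hM : Continuous ↿M) {K κ : ℝ≥0} (hκ : 0 < κ)
    (hK : ∀ t, LipschitzWith K (M t)) (hT : 0 ≤ T) (z₀ : E) :
    LipschitzWith (K / κ) (weightedPicard hM hT κ z₀) := by
  refine LipschitzWith.of_dist_le_mul fun Y Y' => ?_
  refine (ContinuousMap.dist_le (by positivity)).2 fun t => ?_
  set z : C(Icc (0 : ℝ) T, E) → ℝ → E := fun Y τ => Real.exp (κ * τ) • IccExtend hT Y τ
  have hcont : ∀ Y, Continuous fun τ => M τ (z Y τ) := fun Y =>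
    hM.comp (continuous_id.prodMk (Continuous.smul (by fun_prop) Y.continuous.Icc_extend'))
  have hlip : ∀ τ, ‖M τ (z Y τ) - M τ (z Y' τ)‖ ≤ K * dist Y Y' * Real.exp (κ * τ) := fun τ => by
    calc ‖M τ (z Y τ) - M τ (z Y' τ)‖ ≤ K * ‖z Y τ - z Y' τ‖ := (hK τ).norm_sub_le _ _
      _ = K * (Real.exp (κ * τ) * dist (IccExtend hT Y τ) (IccExtend hT Y' τ)) := by
        rw [← smul_sub, norm_smul, Real.norm_of_nonneg (Real.exp_pos _).le, dist_eq_norm]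
      _ ≤ K * (Real.exp (κ * τ) * dist Y Y') := by
        gcongr
        exact ContinuousMap.dist_apply_le_dist _
      _ = K * dist Y Y' * Real.exp (κ * τ) := by ring
  calc dist (weightedPicard hM hT κ z₀ Y t) (weightedPicard hM hT κ z₀ Y' t)
      = Real.exp (-(κ * t)) * ‖∫ τ in (0 : ℝ)..t, (M τ (z Y τ) - M τ (z Y' τ))‖ := by
        rw [intervalIntegral.integral_sub ((hcont Y).intervalIntegrable _ _)
          ((hcont Y').intervalIntegrable _ _)]
        simp only [weightedPicard, ContinuousMap.coe_mk, ODE.picard, dist_eq_norm, ← smul_sub,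
          norm_smul, add_sub_add_left_eq_sub, Real.norm_of_nonneg (Real.exp_pos _).le, z]
    _ ≤ Real.exp (-(κ * t)) * ∫ τ in (0 : ℝ)..t, K * dist Y Y' * Real.exp (κ * τ) := by
        gcongr
        exact intervalIntegral.norm_integral_le_of_norm_le t.2.1
          (Eventually.of_forall fun τ _ => hlip τ) (Continuous.intervalIntegrable (by fun_prop) _ _)
    _ = K * dist Y Y' * (Real.exp (-(κ * t)) * ∫ τ in (0 : ℝ)..t, Real.exp (κ * τ)) := by
        rw [intervalIntegral.integral_const_mul]; ring
    _ ≤ K * dist Y Y' * (κ : ℝ)⁻¹ := by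
        gcongr
        exact exp_neg_mul_integral_exp_le hκ t
    _ = (K / κ : ℝ≥0) * dist Y Y' := by push_cast; ring

theorem exists_forall_hasDerivWithinAt_of_lipschitzWith [CompleteSpace E] (hM : Continuous ↿M)
    {K : ℝ≥0} (hK : ∀ t, LipschitzWith K (M t)) (hT : 0 ≤ T) (z₀ : E) :
    ∃ z : ℝ → E, Continuous z ∧ z 0 = z₀ ∧
      ∀ t ∈ Icc 0 T, HasDerivWithinAt z (M t (z t)) (Icc 0 T) t := by
  set κ : ℝ≥0 := 2 * K + 1
  have hcontr : ContractingWith (K / κ) (weightedPicard hM hT κ z₀) := by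
    refine ⟨?_, lipschitzWith_weightedPicard hM (by positivity) hK hT z₀⟩
    rw [div_lt_one (by positivity), ← NNReal.coe_lt_coe]
    push_cast [κ]
    linarith [K.2]
  obtain ⟨Y, hY⟩ : ∃ Y, weightedPicard hM hT κ z₀ Y = Y :=
    have : Nonempty C(Icc (0 : ℝ) T, E) := ⟨0⟩
    ⟨_, hcontr.fixedPoint_isFixedPt⟩
  set z : ℝ → E := fun τ => Real.exp (κ * τ) • IccExtend hT Y τ
  have hz : Continuous z := Continuous.smul (by fun_prop) Y.continuous.Icc_extend'
  have hfix : ∀ t ∈ Icc 0 T, z t = ODE.picard M 0 z₀ z t := fun t ht => by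
    calc z t = Real.exp (κ * t) • weightedPicard hM hT κ z₀ Y ⟨t, ht⟩ := by
          rw [hY, ← IccExtend_of_mem hT Y ht]
      _ = ODE.picard M 0 z₀ z t := by
          simp [weightedPicard, smul_smul, ← Real.exp_add, z]
  refine ⟨z, hz, (hfix 0 (left_mem_Icc.2 hT)).trans ODE.picard_apply₀, fun t ht => ?_⟩
  exact (ODE.hasDerivWithinAt_picard_Icc (u := univ) (left_mem_Icc.2 hT) hM.continuousOn
    hz.continuousOn (fun _ _ => mem_univ _) z₀ ht).congr hfix (hfix t ht)

end LipschitzODE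

section HilbertBasis

variable {ι 𝕜 H : Type*} [RCLike 𝕜] [NormedAddCommGroup H] [InnerProductSpace 𝕜 H]
  (b : HilbertBasis ι 𝕜 H)

theorem hasSum_norm_sq_inner (x : H) : HasSum (fun i => ‖⟪b i, x⟫_𝕜‖ ^ 2) (‖x‖ ^ 2) := by
  simpa [b.repr_apply_apply] using lp.hasSum_norm (by norm_num) (b.repr x)

theorem norm_le_mul_of_forall_norm_inner_le {x y : H} {C : ℝ} (hC : 0 ≤ C)
    (h : ∀ i, ‖⟪b i, y⟫_𝕜‖ ≤ C * ‖⟪b i, x⟫_𝕜‖) : ‖y‖ ≤ C * ‖x‖ := by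
  refine le_of_sq_le_sq ?_ (by positivity)
  rw [mul_pow]
  refine hasSum_le (fun i => ?_) (hasSum_norm_sq_inner b y)
    ((hasSum_norm_sq_inner b x).mul_left (C ^ 2))
  rw [← mul_pow]
  gcongr
  exact h i

theorem ext_inner_hilbertBasis {x y : H} (h : ∀ i, ⟪b i, x⟫_𝕜 = ⟪b i, y⟫_𝕜) : x = y :=
  b.repr.injective (lp.ext (funext fun i => by simpa only [b.repr_apply_apply] using h i))

section Diagonal

variable {m : ι → 𝕜} {C : ℝ≥0}

theorem memℓp_two_mul (hm : ∀ i, ‖m i‖ ≤ C) (c : lp (fun _ : ι => 𝕜) 2) :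
    Memℓp (fun i => m i * c i) 2 :=
  ((lp.memℓp c).norm.const_mul (C : ℝ)).mono fun i => by
    rw [norm_mul]
    gcongr
    exact hm i

/-- The bounded operator on `H` that is diagonal in the Hilbert basis `b`, with the bounded family
`m` on the diagonal. -/
def diagonalOp (hm : ∀ i, ‖m i‖ ≤ C) : H →L[𝕜] H :=
  LinearMap.mkContinuous
    { toFun x := b.repr.symm ⟨fun i => m i * b.repr x i, memℓp_two_mul hm _⟩
      map_add' x y := ext_inner_hilbertBasis b fun i => by
        simpa [← b.repr_apply_apply] using! mul_add (m i) (b.repr x i) (b.repr y i)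
      map_smul' a x := ext_inner_hilbertBasis b fun i => by
        simp [← b.repr_apply_apply, mul_left_comm] }
    C fun x => norm_le_mul_of_forall_norm_inner_le b C.2 fun i => by
      simp only [← b.repr_apply_apply, LinearMap.coe_mk, AddHom.coe_mk,
        LinearIsometryEquiv.apply_symm_apply, norm_mul]
      gcongr
      exact hm i

@[simp]
theorem inner_diagonalOp (hm : ∀ i, ‖m i‖ ≤ C) (x : H) (i : ι) :
    ⟪b i, diagonalOp b hm x⟫_𝕜 = m i * ⟪b i, x⟫_𝕜 := by
  simp [diagonalOp, ← b.repr_apply_apply]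

theorem diagonalOp_apply_self (hm : ∀ i, ‖m i‖ ≤ C) (i : ι) :
    diagonalOp b hm (b i) = m i • b i := by
  classical
  refine ext_inner_hilbertBasis b fun j => ?_
  rw [inner_diagonalOp, inner_smul_right, orthonormal_iff_ite.1 b.orthonormal]
  split_ifs with h <;> simp [h]

theorem lipschitzWith_diagonalOp (hm : ∀ i, ‖m i‖ ≤ C) : LipschitzWith C (diagonalOp b hm) :=
  (diagonalOp b hm).lipschitz.weaken (LinearMap.mkContinuous_norm_le _ C.2 _)

theorem inner_diagonalOp_left_eq_right {m : ι → ℝ} (hm : ∀ i, ‖(m i : 𝕜)‖ ≤ C) (x y : H) :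
    ⟪diagonalOp b hm x, y⟫_𝕜 = ⟪x, diagonalOp b hm y⟫_𝕜 := by
  refine (b.hasSum_inner_mul_inner (diagonalOp b hm x) y).unique ?_
  convert b.hasSum_inner_mul_inner x (diagonalOp b hm y) using 2 with i
  rw [← inner_conj_symm (diagonalOp b hm x), inner_diagonalOp, inner_diagonalOp, map_mul,
    inner_conj_symm, RCLike.conj_ofReal, mul_left_comm, mul_assoc]

theorem continuous_diagonalOp_apply {X : Type*} [TopologicalSpace X] {m : X → ι → 𝕜}
    (hm : ∀ t i, ‖m t i‖ ≤ C) (hcont : ∀ i, Continuous fun t => m t i) :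
    Continuous fun p : X × H => diagonalOp b (hm p.1) p.2 := by
  have hdense : Dense (Submodule.span 𝕜 (range b) : Set H) :=
    Submodule.dense_iff_topologicalClosure_eq_top.2 b.dense_span
  refine continuous_prod_of_dense_continuous_lipschitzWith' _ C hdense
    (fun t => lipschitzWith_diagonalOp b (hm t)) fun x hx => ?_
  induction hx using Submodule.span_induction with
  | mem x hx =>
    obtain ⟨i, rfl⟩ := hx
    simp only [diagonalOp_apply_self]
    exact (hcont i).smul continuous_const
  | zero => simpa only [map_zero] using continuous_const
  | add x y _ _ hx hy => simpa only [map_add] using! hx.add hy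
  | smul a x _ hx => simpa only [map_smul] using! hx.const_smul a

end Diagonal

variable [NormedSpace ℝ H] [CompleteSpace H]

theorem hasDerivWithinAt_of_forall_inner {x y : ℝ → H} {α β : ℝ} (hy : Continuous y)
    (h : ∀ i, ∀ t ∈ Icc α β,
      HasDerivWithinAt (fun t => ⟪b i, x t⟫_𝕜) ⟪b i, y t⟫_𝕜 (Icc α β) t)
    {t : ℝ} (ht : t ∈ Icc α β) : HasDerivWithinAt x (y t) (Icc α β) t := by
  set z : ℝ → H := fun t => x α + ∫ τ in α..t, y τ
  have hz : ∀ t, HasDerivAt z (y t) t := fun t =>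
    (hy.integral_hasStrictDerivAt α t).hasDerivAt.const_add (x α)
  have hzi : ∀ i t, HasDerivAt (fun t => ⟪b i, z t⟫_𝕜) ⟪b i, y t⟫_𝕜 t := fun i t => by
    simpa using (hasDerivAt_const t (b i)).inner 𝕜 (hz t)
  have hxz : ∀ t ∈ Icc α β, x t = z t := fun t ht => ext_inner_hilbertBasis b fun i => by
    refine eq_of_derivWithin_eq (fun t ht => (h i t ht).differentiableWithinAt)
      (fun t _ => (hzi i t).differentiableAt.differentiableWithinAt) (fun t ht => ?_)
      (by simp [z]) t ht
    have hunique : UniqueDiffWithinAt ℝ (Icc α β) t :=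
      uniqueDiffOn_Icc (ht.1.trans_lt ht.2) t (Ico_subset_Icc_self ht)
    rw [(h i t (Ico_subset_Icc_self ht)).derivWithin hunique,
      (hzi i t).hasDerivWithinAt.derivWithin hunique]
  exact (hz t).hasDerivWithinAt.congr hxz (hxz t ht)

end HilbertBasis

section BoundedPerturbation

variable {𝕜 K : Type*} [RCLike 𝕜] [NormedAddCommGroup K] [InnerProductSpace 𝕜 K]
  {U : ℝ → K →L[𝕜] K}

theorem norm_apply_of_inner_eq_of_inverse (hadj : ∀ t x y, ⟪U t x, y⟫_𝕜 = ⟪x, U (-t) y⟫_𝕜)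
    (hinv : ∀ t x, U t (U (-t) x) = x) (t : ℝ) (x : K) : ‖U t x‖ = ‖x‖ := by
  have hinv' : U (-t) (U t x) = x := by simpa using hinv (-t) x
  rw [@norm_eq_sqrt_re_inner 𝕜, @norm_eq_sqrt_re_inner 𝕜, hadj, hinv']

/-- In the interaction picture `z = U(t) y` the perturbed equation becomes the linear equation
`y' = -U(-t) P U(t) y` with bounded coefficients, so that no generator of `U` is needed: its
adjoint acts on the test vectors `x` as the derivative `x'` of `U(-t) x`. -/
theorem exists_bounded_perturbation [NormedSpace ℝ K] [CompleteSpace K]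
    (hU : Continuous fun p : ℝ × K => U p.1 p.2)
    (hadj : ∀ t x y, ⟪U t x, y⟫_𝕜 = ⟪x, U (-t) y⟫_𝕜) (hinv : ∀ t x, U t (U (-t) x) = x)
    (P : K →L[𝕜] K) {T : ℝ} (hT : 0 ≤ T) (z₀ : K) :
    ∃ z : ℝ → K, Continuous z ∧ z 0 = z₀ ∧
      (∀ x x' t, t ∈ Icc 0 T → HasDerivWithinAt (fun τ => U (-τ) x) (U (-t) x') (Icc 0 T) t →
        HasDerivWithinAt (fun τ => ⟪x, z τ⟫_𝕜) (⟪x', z t⟫_𝕜 - ⟪x, P (z t)⟫_𝕜) (Icc 0 T) t) ∧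
      ∀ t ∈ Icc 0 T, HasDerivWithinAt (fun τ => ‖z τ‖ ^ 2)
        (-(2 * RCLike.re ⟪z t, P (z t)⟫_𝕜)) (Icc 0 T) t := by
  have hnorm := norm_apply_of_inner_eq_of_inverse hadj hinv
  have hadj' : ∀ t x y, ⟪U (-t) x, y⟫_𝕜 = ⟪x, U t y⟫_𝕜 := fun t x y => by
    rw [hadj, neg_neg]
  obtain ⟨y, hy, hy0, hderiv⟩ := exists_forall_hasDerivWithinAt_of_lipschitzWith
    (M := fun t y => -U (-t) (P (U t y))) (K := ‖P‖₊)
    (hU.comp (continuous_fst.neg.prodMk (P.continuous.comp hU))).neg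
    (fun t => LipschitzWith.of_dist_le_mul fun x y => by
      rw [dist_neg_neg, dist_eq_norm, ← map_sub, ← map_sub, ← map_sub, hnorm, dist_eq_norm]
      exact (P.le_opNorm _).trans_eq (by rw [hnorm, coe_nnnorm])) hT (U (-0) z₀)
  refine ⟨fun t => U t (y t), hU.comp (continuous_id.prodMk hy), ?_, fun x x' t ht hx => ?_,
    fun t ht => ?_⟩
  · simp only [hy0, hinv]
  · convert! hx.inner 𝕜 (hderiv t ht) using 1
    · simp only [hadj']
    · rw [inner_neg_right, hadj', hadj', hinv]
      ring
  · have hre := (RCLike.reCLM (K := 𝕜)).hasFDerivAt.comp_hasDerivWithinAt t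
      ((hderiv t ht).inner 𝕜 (hderiv t ht))
    convert! hre using 1
    · funext τ
      simp [hnorm]
    · rw [RCLike.reCLM_apply, map_add, inner_neg_right, inner_neg_left, hadj', ← hadj, map_neg,
        map_neg, inner_re_symm (P _)]
      ring

end BoundedPerturbation

section DampedWave

variable {ι 𝕜 H : Type*} [RCLike 𝕜] [NormedAddCommGroup H] [InnerProductSpace 𝕜 H]
  (b : HilbertBasis ι 𝕜 H) (ω : ι → ℝ)

/-- `cos (t Ω)`, where `Ω` is the diagonal operator with entries `ω i`. -/
def cosOp (t : ℝ) : H →L[𝕜] H :=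
  diagonalOp b (m := fun i => ((Real.cos (t * ω i) : ℝ) : 𝕜)) (C := 1) fun i => by
    simpa using Real.abs_cos_le_one (t * ω i)

/-- `sin (t Ω)`, where `Ω` is the diagonal operator with entries `ω i`. -/
def sinOp (t : ℝ) : H →L[𝕜] H :=
  diagonalOp b (m := fun i => ((Real.sin (t * ω i) : ℝ) : 𝕜)) (C := 1) fun i => by
    simpa using Real.abs_sin_le_one (t * ω i)

@[simp]
theorem inner_cosOp (t : ℝ) (x : H) (i : ι) :
    ⟪b i, cosOp b ω t x⟫_𝕜 = (Real.cos (t * ω i) : ℝ) * ⟪b i, x⟫_𝕜 :=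
  inner_diagonalOp b _ x i

@[simp]
theorem inner_sinOp (t : ℝ) (x : H) (i : ι) :
    ⟪b i, sinOp b ω t x⟫_𝕜 = (Real.sin (t * ω i) : ℝ) * ⟪b i, x⟫_𝕜 :=
  inner_diagonalOp b _ x i

theorem inner_cosOp_left_eq_right (t : ℝ) (x y : H) :
    ⟪cosOp b ω t x, y⟫_𝕜 = ⟪x, cosOp b ω t y⟫_𝕜 :=
  inner_diagonalOp_left_eq_right b _ x y

theorem inner_sinOp_left_eq_right (t : ℝ) (x y : H) :
    ⟪sinOp b ω t x, y⟫_𝕜 = ⟪x, sinOp b ω t y⟫_𝕜 :=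
  inner_diagonalOp_left_eq_right b _ x y

theorem cosOp_neg (t : ℝ) (x : H) : cosOp b ω (-t) x = cosOp b ω t x :=
  ext_inner_hilbertBasis b fun i => by simp

theorem sinOp_neg (t : ℝ) (x : H) : sinOp b ω (-t) x = -sinOp b ω t x :=
  ext_inner_hilbertBasis b fun i => by simp

theorem cosOp_cosOp_add_sinOp_sinOp (t : ℝ) (x : H) :
    cosOp b ω t (cosOp b ω t x) + sinOp b ω t (sinOp b ω t x) = x :=
  ext_inner_hilbertBasis b fun i => by
    rw [inner_add_right, inner_cosOp, inner_cosOp, inner_sinOp, inner_sinOp, ← mul_assoc,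
      ← mul_assoc, ← add_mul]
    norm_cast
    simp [← sq]

theorem cosOp_sinOp_comm (t : ℝ) (x : H) :
    cosOp b ω t (sinOp b ω t x) = sinOp b ω t (cosOp b ω t x) :=
  ext_inner_hilbertBasis b fun i => by
    rw [inner_cosOp, inner_sinOp, inner_sinOp, inner_cosOp, mul_left_comm]

theorem continuous_cosOp_apply : Continuous fun p : ℝ × H => cosOp b ω p.1 p.2 :=
  continuous_diagonalOp_apply b _ fun _ => RCLike.continuous_ofReal.comp (by fun_prop)

theorem continuous_sinOp_apply : Continuous fun p : ℝ × H => sinOp b ω p.1 p.2 :=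
  continuous_diagonalOp_apply b _ fun _ => RCLike.continuous_ofReal.comp (by fun_prop)

section Derivative

variable [NormedSpace ℝ H] [CompleteSpace H] {b ω} {f g : H} {α β t : ℝ}

theorem hasDerivWithinAt_cosOp (hfg : ∀ i, ⟪b i, g⟫_𝕜 = ω i * ⟪b i, f⟫_𝕜) (ht : t ∈ Icc α β) :
    HasDerivWithinAt (fun τ => cosOp b ω τ f) (-sinOp b ω t g) (Icc α β) t := by
  refine hasDerivWithinAt_of_forall_inner b (y := fun τ => -sinOp b ω τ g)
    (continuous_sinOp_apply b ω).along_fst.neg (fun i t _ => ?_) ht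
  have hcos : HasDerivAt (fun τ : ℝ => Real.cos (τ * ω i)) (-Real.sin (t * ω i) * ω i) t :=
    (Real.hasDerivAt_cos _).comp t (hasDerivAt_mul_const (ω i))
  have hofReal : HasDerivAt (fun τ : ℝ => ((Real.cos (τ * ω i) : ℝ) : 𝕜))
      ((-Real.sin (t * ω i) * ω i : ℝ) : 𝕜) t :=
    (RCLike.ofRealCLM (K := 𝕜)).hasFDerivAt.comp_hasDerivAt
      (f := fun τ => Real.cos (τ * ω i)) t hcos
  have hmul := (hofReal.mul_const ⟪b i, f⟫_𝕜).hasDerivWithinAt (s := Icc α β)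
  simpa [hfg, mul_assoc] using hmul

theorem hasDerivWithinAt_sinOp (hfg : ∀ i, ⟪b i, g⟫_𝕜 = ω i * ⟪b i, f⟫_𝕜) (ht : t ∈ Icc α β) :
    HasDerivWithinAt (fun τ => sinOp b ω τ f) (cosOp b ω t g) (Icc α β) t := by
  refine hasDerivWithinAt_of_forall_inner b (y := fun τ => cosOp b ω τ g)
    (continuous_cosOp_apply b ω).along_fst (fun i t _ => ?_) ht
  have hsin : HasDerivAt (fun τ : ℝ => Real.sin (τ * ω i)) (Real.cos (t * ω i) * ω i) t :=
    (Real.hasDerivAt_sin _).comp t (hasDerivAt_mul_const (ω i))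
  have hofReal : HasDerivAt (fun τ : ℝ => ((Real.sin (τ * ω i) : ℝ) : 𝕜))
      ((Real.cos (t * ω i) * ω i : ℝ) : 𝕜) t :=
    (RCLike.ofRealCLM (K := 𝕜)).hasFDerivAt.comp_hasDerivAt
      (f := fun τ => Real.sin (τ * ω i)) t hsin
  have hmul := (hofReal.mul_const ⟪b i, f⟫_𝕜).hasDerivWithinAt (s := Icc α β)
  simpa [hfg, mul_assoc] using hmul

end Derivative

/-- The unitary group of the free equation `w' = Ω v`, `v' = -Ω w`, that is `u'' + Ω² u = 0` in the
energy variables `w = Ω u` and `v = u'`. -/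
def waveGroup (t : ℝ) : WithLp 2 (H × H) →L[𝕜] WithLp 2 (H × H) :=
  (WithLp.prodContinuousLinearEquiv 2 𝕜 H H).symm.toContinuousLinearMap ∘L
    (cosOp b ω t ∘L WithLp.fstL 2 𝕜 H H + sinOp b ω t ∘L WithLp.sndL 2 𝕜 H H).prod
      (cosOp b ω t ∘L WithLp.sndL 2 𝕜 H H - sinOp b ω t ∘L WithLp.fstL 2 𝕜 H H)

theorem waveGroup_apply (t : ℝ) (z : WithLp 2 (H × H)) :
    waveGroup b ω t z = WithLp.toLp 2 (cosOp b ω t z.fst + sinOp b ω t z.snd,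
      cosOp b ω t z.snd - sinOp b ω t z.fst) :=
  rfl

theorem continuous_waveGroup_apply :
    Continuous fun p : ℝ × WithLp 2 (H × H) => waveGroup b ω p.1 p.2 := by
  have hfst : Continuous fun p : ℝ × WithLp 2 (H × H) => (p.1, p.2.fst) :=
    continuous_fst.prodMk ((WithLp.fstL 2 𝕜 H H).continuous.comp continuous_snd)
  have hsnd : Continuous fun p : ℝ × WithLp 2 (H × H) => (p.1, p.2.snd) :=
    continuous_fst.prodMk ((WithLp.sndL 2 𝕜 H H).continuous.comp continuous_snd)
  have hcos := continuous_cosOp_apply b ω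
  have hsin := continuous_sinOp_apply b ω
  have hw := (hcos.comp hfst).add (hsin.comp hsnd)
  have hv := (hcos.comp hsnd).sub (hsin.comp hfst)
  exact (WithLp.prod_continuous_toLp 2 H H).comp (hw.prodMk hv)

theorem inner_waveGroup_left (t : ℝ) (x y : WithLp 2 (H × H)) :
    ⟪waveGroup b ω t x, y⟫_𝕜 = ⟪x, waveGroup b ω (-t) y⟫_𝕜 := by
  simp only [waveGroup_apply, WithLp.prod_inner_apply, WithLp.ofLp_fst, WithLp.ofLp_snd, cosOp_neg,
    sinOp_neg, inner_add_left, inner_sub_left, inner_add_right, inner_sub_right, inner_neg_right,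
    inner_cosOp_left_eq_right, inner_sinOp_left_eq_right]
  ring

theorem waveGroup_waveGroup_neg (t : ℝ) (x : WithLp 2 (H × H)) :
    waveGroup b ω t (waveGroup b ω (-t) x) = x := by
  have hcs := cosOp_cosOp_add_sinOp_sinOp b ω t
  refine WithLp.ofLp_injective 2 (Prod.ext ?_ ?_)
  · rw [WithLp.ofLp_fst x, ← hcs x.fst]
    simp [waveGroup_apply, cosOp_neg, sinOp_neg, cosOp_sinOp_comm]
  · rw [WithLp.ofLp_snd x, ← hcs x.snd]
    simp [waveGroup_apply, cosOp_neg, sinOp_neg, cosOp_sinOp_comm]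
    abel

section Derivative

variable [NormedSpace ℝ H] [CompleteSpace H] {b ω} {f f' g g' : H} {α β t : ℝ}

theorem hasDerivWithinAt_waveGroup_neg (hf : ∀ i, ⟪b i, f'⟫_𝕜 = ω i * ⟪b i, f⟫_𝕜)
    (hg : ∀ i, ⟪b i, g'⟫_𝕜 = ω i * ⟪b i, g⟫_𝕜) (ht : t ∈ Icc α β) :
    HasDerivWithinAt (fun τ => waveGroup b ω (-τ) (WithLp.toLp 2 (f, g)))
      (waveGroup b ω (-t) (WithLp.toLp 2 (-g', f'))) (Icc α β) t := by
  have hfst := (hasDerivWithinAt_cosOp hf ht).sub (hasDerivWithinAt_sinOp hg ht)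
  have hsnd := (hasDerivWithinAt_cosOp hg ht).add (hasDerivWithinAt_sinOp hf ht)
  have hprod := (WithLp.prodContinuousLinearEquiv 2 ℝ H H).symm.toContinuousLinearMap.hasFDerivAt
    |>.comp_hasDerivWithinAt t (hfst.prodMk hsnd)
  convert! hprod using 1
  · funext τ
    simp [waveGroup_apply, cosOp_neg, sinOp_neg, ← sub_eq_add_neg]
  · refine WithLp.ofLp_injective 2 (Prod.ext ?_ ?_)
    · simp [waveGroup_apply, cosOp_neg, sinOp_neg, sub_eq_add_neg, add_comm]
    · simp [waveGroup_apply, cosOp_neg, sinOp_neg, sub_eq_add_neg, add_comm]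

end Derivative

/-- `u` is a solution of `u'' + Ω² u + A u + B u' = 0` on `[0,T]`, in the weak sense that the
equation is tested with elements of the domain of `Ω`, with `v = u'`, `w = Ω u` and the energy
identity for `‖w‖² + ‖v‖²`. -/
structure IsDampedWave [NormedSpace ℝ H] (A B : H →L[𝕜] H) (T : ℝ) (u v w : ℝ → H) : Prop where
  continuous_v : Continuous v
  continuous_w : Continuous w
  inner_w : ∀ t i, ⟪b i, w t⟫_𝕜 = ω i * ⟪b i, u t⟫_𝕜
  hasDerivWithinAt : ∀ t ∈ Icc 0 T, HasDerivWithinAt u (v t) (Icc 0 T) t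
  hasDerivWithinAt_inner : ∀ f g : H, (∀ i, ⟪b i, g⟫_𝕜 = ω i * ⟪b i, f⟫_𝕜) → ∀ t ∈ Icc 0 T,
    HasDerivWithinAt (fun τ => ⟪f, v τ⟫_𝕜) (-(⟪g, w t⟫_𝕜 + ⟪f, A (u t)⟫_𝕜 + ⟪f, B (v t)⟫_𝕜))
      (Icc 0 T) t
  hasDerivWithinAt_energy : ∀ t ∈ Icc 0 T,
    HasDerivWithinAt (fun τ => ‖w τ‖ ^ 2 + ‖v τ‖ ^ 2)
      (-(2 * RCLike.re ⟪v t, A (u t) + B (v t)⟫_𝕜)) (Icc 0 T) t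

variable {b ω}

theorem exists_forall_mul_inner_eq {δ : ℝ} (hδ : 0 < δ) (hω : ∀ i, δ ≤ ω i) :
    ∃ O : H →L[𝕜] H, ∀ x i, ω i * ⟪b i, O x⟫_𝕜 = ⟪b i, x⟫_𝕜 := by
  have hbound (i : ι) : ‖(((ω i)⁻¹ : ℝ) : 𝕜)‖ ≤ (δ⁻¹).toNNReal := by
    rw [RCLike.norm_ofReal, abs_of_pos (inv_pos.2 (hδ.trans_le (hω i))),
      Real.coe_toNNReal _ (inv_pos.2 hδ).le]
    exact inv_anti₀ hδ (hω i)
  refine ⟨diagonalOp b hbound, fun x i => ?_⟩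
  have hi : (ω i : 𝕜) ≠ 0 := RCLike.ofReal_ne_zero.2 (hδ.trans_le (hω i)).ne'
  rw [inner_diagonalOp, RCLike.ofReal_inv, mul_inv_cancel_left₀ hi]

variable [NormedSpace ℝ H]

/-- With `A Ω⁻¹` in place of `A`, this is the second-order equation in the energy variables
`w = Ω u` and `v = u'`. -/
theorem exists_hasDerivWithinAt_energyVariables [CompleteSpace H] (A B : H →L[𝕜] H) {T : ℝ}
    (hT : 0 ≤ T) (w₀ v₀ : H) :
    ∃ w v : ℝ → H, Continuous w ∧ Continuous v ∧ w 0 = w₀ ∧ v 0 = v₀ ∧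
      (∀ f f' g g', (∀ i, ⟪b i, f'⟫_𝕜 = ω i * ⟪b i, f⟫_𝕜) →
        (∀ i, ⟪b i, g'⟫_𝕜 = ω i * ⟪b i, g⟫_𝕜) → ∀ t ∈ Icc 0 T,
        HasDerivWithinAt (fun τ => ⟪f, w τ⟫_𝕜 + ⟪g, v τ⟫_𝕜)
          (⟪f', v t⟫_𝕜 - ⟪g', w t⟫_𝕜 - ⟪g, A (w t) + B (v t)⟫_𝕜) (Icc 0 T) t) ∧
      ∀ t ∈ Icc 0 T, HasDerivWithinAt (fun τ => ‖w τ‖ ^ 2 + ‖v τ‖ ^ 2)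
        (-(2 * RCLike.re ⟪v t, A (w t) + B (v t)⟫_𝕜)) (Icc 0 T) t := by
  let P : WithLp 2 (H × H) →L[𝕜] WithLp 2 (H × H) :=
    (WithLp.prodContinuousLinearEquiv 2 𝕜 H H).symm.toContinuousLinearMap ∘L
      (0 : WithLp 2 (H × H) →L[𝕜] H).prod (A ∘L WithLp.fstL 2 𝕜 H H + B ∘L WithLp.sndL 2 𝕜 H H)
  have hP (x z : WithLp 2 (H × H)) : ⟪x, P z⟫_𝕜 = ⟪x.snd, A z.fst + B z.snd⟫_𝕜 := by
    simp [P, WithLp.prod_inner_apply]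
  obtain ⟨z, hz, hz0, hweak, henergy⟩ := exists_bounded_perturbation
    (continuous_waveGroup_apply b ω) (inner_waveGroup_left b ω) (waveGroup_waveGroup_neg b ω)
    P hT (WithLp.toLp 2 (w₀, v₀))
  refine ⟨fun t => (z t).fst, fun t => (z t).snd, (WithLp.fstL 2 𝕜 H H).continuous.comp hz,
    (WithLp.sndL 2 𝕜 H H).continuous.comp hz, congrArg WithLp.fst hz0,
    congrArg WithLp.snd hz0,
    fun f f' g g' hf hg t ht => ?_, fun t ht => ?_⟩
  · have h := hweak _ _ t ht (hasDerivWithinAt_waveGroup_neg hf hg ht)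
    simp only [hP, WithLp.prod_inner_apply, WithLp.ofLp_fst, WithLp.ofLp_snd, WithLp.toLp_snd,
      inner_neg_left, neg_add_eq_sub] at h
    exact h
  · simpa only [WithLp.prod_norm_sq_eq_of_L2, hP] using henergy t ht

theorem exists_isDampedWave [CompleteSpace H] {δ : ℝ} (hδ : 0 < δ) (hω : ∀ i, δ ≤ ω i)
    (A B : H →L[𝕜] H) {T : ℝ} (hT : 0 ≤ T) {u₀ w₀ : H}
    (h₀ : ∀ i, ⟪b i, w₀⟫_𝕜 = ω i * ⟪b i, u₀⟫_𝕜) (v₀ : H) :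
    ∃ u v w, IsDampedWave b ω A B T u v w ∧ u 0 = u₀ ∧ v 0 = v₀ ∧ w 0 = w₀ := by
  obtain ⟨O, hO⟩ := exists_forall_mul_inner_eq (𝕜 := 𝕜) (b := b) hδ hω
  have hω0 (i : ι) : (ω i : 𝕜) ≠ 0 := RCLike.ofReal_ne_zero.2 (hδ.trans_le (hω i)).ne'
  obtain ⟨w, v, hw, hv, hw0, hv0, hweak, henergy⟩ :=
    exists_hasDerivWithinAt_energyVariables (b := b) (ω := ω) (A ∘L O) B hT w₀ v₀
  refine ⟨fun t => O (w t), v, w, ⟨hv, hw, fun t i => (hO _ i).symm, fun t ht => ?_,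
    fun f g hfg t ht => ?_, henergy⟩,
    ext_inner_hilbertBasis b fun i => mul_left_cancel₀ (hω0 i) (by rw [hO, hw0, h₀]), hv0, hw0⟩
  · refine hasDerivWithinAt_of_forall_inner b hv (fun i t ht => ?_) ht
    have hbi (j : ι) : ⟪b j, (ω i : 𝕜) • b i⟫_𝕜 = ω j * ⟪b j, b i⟫_𝕜 := by
      rcases eq_or_ne j i with rfl | hji
      · rw [inner_smul_right]
      · rw [inner_smul_right, b.orthonormal.inner_eq_zero hji, mul_zero, mul_zero]
    have hi := (hweak (b i) _ 0 0 hbi (by simp) t ht).const_mul (ω i : 𝕜)⁻¹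
    have hOi (x : H) : ⟪b i, O x⟫_𝕜 = (ω i : 𝕜)⁻¹ * ⟪b i, x⟫_𝕜 := by
      rw [← hO x i, inv_mul_cancel_left₀ (hω0 i)]
    rw [inner_smul_left, RCLike.conj_ofReal] at hi
    simpa [hOi, hω0 i] using hi
  · simpa [inner_add_right, sub_eq_add_neg, add_comm, add_left_comm] using
      hweak 0 0 f g (by simp) hfg t ht

theorem IsDampedWave.energy_le {A B : H →L[𝕜] H} {T : ℝ} {u v w : ℝ → H}
    (h : IsDampedWave b ω A B T u v w) (hA : A.IsPositive)
    (hB : ∀ x, 0 ≤ RCLike.re ⟪x, B x⟫_𝕜) {t : ℝ} (ht : t ∈ Icc 0 T) :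
    ‖w t‖ ^ 2 + ‖v t‖ ^ 2 ≤ ‖w 0‖ ^ 2 + ‖v 0‖ ^ 2 + ‖A‖ * ‖u 0‖ ^ 2 := by
  let E : ℝ → ℝ := fun τ => ‖w τ‖ ^ 2 + ‖v τ‖ ^ 2 + RCLike.re ⟪u τ, A (u τ)⟫_𝕜
  have hE (τ : ℝ) (hτ : τ ∈ Icc 0 T) :
      HasDerivWithinAt E (-(2 * RCLike.re ⟪v τ, B (v τ)⟫_𝕜)) (Icc 0 T) τ := by
    have hu := h.hasDerivWithinAt τ hτ
    have hAu := (A.restrictScalars ℝ).hasFDerivAt.comp_hasDerivWithinAt τ hu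
    have hre := (RCLike.reCLM (K := 𝕜)).hasFDerivAt.comp_hasDerivWithinAt τ (hu.inner 𝕜 hAu)
    convert! (h.hasDerivWithinAt_energy τ hτ).add hre using 1
    have hsymm : RCLike.re ⟪u τ, A (v τ)⟫_𝕜 = RCLike.re ⟪v τ, A (u τ)⟫_𝕜 := by
      rw [← inner_re_symm, ← hA.inner_left_eq_inner_right]
    simp only [RCLike.reCLM_apply, map_add, inner_add_right, Function.comp_apply,
      ContinuousLinearMap.coe_restrictScalars', hsymm]
    ring
  have hanti : AntitoneOn E (Icc 0 T) :=
    antitoneOn_of_hasDerivWithinAt_nonpos (convex_Icc 0 T)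
      (fun τ hτ => (hE τ hτ).continuousWithinAt)
      (fun τ hτ => (hE τ (interior_subset hτ)).mono interior_subset)
      fun τ _ => by simpa using hB (v τ)
  have h0 : RCLike.re ⟪u 0, A (u 0)⟫_𝕜 ≤ ‖A‖ * ‖u 0‖ ^ 2 := calc
    RCLike.re ⟪u 0, A (u 0)⟫_𝕜 ≤ ‖u 0‖ * ‖A (u 0)‖ := re_inner_le_norm _ _
    _ ≤ ‖u 0‖ * (‖A‖ * ‖u 0‖) := by gcongr; exact A.le_opNorm _
    _ = ‖A‖ * ‖u 0‖ ^ 2 := by ring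
  have hle := hanti (left_mem_Icc.2 (ht.1.trans ht.2)) ht ht.1
  have hpos := hA.re_inner_nonneg_right (u t)
  simp only [E] at hle
  linarith

end DampedWave

section IntegrationByParts

variable {a b : ℝ}

theorem absolutelyContinuousOnInterval_integral {E : Type*} [NormedAddCommGroup E]
    [NormedSpace ℝ E] {f : ℝ → E} (hf : IntervalIntegrable f volume a b) :
    AbsolutelyContinuousOnInterval (fun x => ∫ t in a..x, f t) a b := by
  have hnorm := hf.norm.absolutelyContinuousOnInterval_intervalIntegral left_mem_uIcc
  refine (absolutelyContinuousOnInterval_iff _ a b).2 fun ε hε => ?_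
  obtain ⟨δ, hδ, H⟩ := (absolutelyContinuousOnInterval_iff _ a b).1 hnorm ε hε
  refine ⟨δ, hδ, fun I hI hlt => (Finset.sum_le_sum fun i hi => ?_).trans_lt (H I hI hlt)⟩
  obtain ⟨hx, hy⟩ := hI.1 i hi
  have hsub {x : ℝ} (hx : x ∈ uIcc a b) := uIcc_subset_uIcc left_mem_uIcc hx
  have hfx {x : ℝ} (hx : x ∈ uIcc a b) := hf.mono_set (hsub hx)
  rw [dist_eq_norm, Real.dist_eq, intervalIntegral.integral_interval_sub_left (hfx hx) (hfx hy),
    intervalIntegral.integral_interval_sub_left (hfx hx).norm (hfx hy).norm]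
  exact intervalIntegral.norm_integral_le_abs_integral_norm

theorem integral_mul_primitive_add_primitive_mul {f g : ℝ → ℂ}
    (hf : IntervalIntegrable f volume a b) (hg : IntervalIntegrable g volume a b) :
    ∫ x in a..b, (f x * (∫ t in a..x, g t) + (∫ t in a..x, f t) * g x) =
      (∫ x in a..b, f x) * ∫ x in a..b, g x := by
  have acf := absolutelyContinuousOnInterval_integral hf
  have acg := absolutelyContinuousOnInterval_integral hg
  have hint : IntervalIntegrable
      (fun x => f x * (∫ t in a..x, g t) + (∫ t in a..x, f t) * g x) volume a b :=
    (hf.mul_continuousOn acg.continuousOn).add (hg.continuousOn_mul acf.continuousOn)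
  have ac := (acf.smul acg).sub (absolutelyContinuousOnInterval_integral hint)
  obtain ⟨C, hC⟩ := ac.const_of_ae_hasDerivAt_zero <| by
    filter_upwards [hf.ae_hasDerivAt_integral, hg.ae_hasDerivAt_integral,
      hint.ae_hasDerivAt_integral] with x hfx hgx hx hmem
    have := ((hfx hmem a left_mem_uIcc).mul (hgx hmem a left_mem_uIcc)).sub
      (hx hmem a left_mem_uIcc)
    simpa only [sub_self] using! this
  have hconst := (hC b right_mem_uIcc).trans (hC a left_mem_uIcc).symm
  simp only [Pi.sub_apply, smul_eq_mul, Pi.mul_apply, intervalIntegral.integral_same, mul_zero,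
    sub_zero] at hconst
  exact (sub_eq_zero.1 hconst).symm

end IntegrationByParts

section InnerOp

variable {𝕜 H X : Type*} [RCLike 𝕜] [NormedAddCommGroup H] [InnerProductSpace 𝕜 H]
  [TopologicalSpace X] [CompactSpace X]

/-- The operator `h ↦ (x ↦ ⟪χ x, h⟫)` given by a continuous family `χ` of vectors. -/
def innerOp (χ : C(X, H)) : H →L[𝕜] BoundedContinuousFunction X 𝕜 :=
  LinearMap.mkContinuous
    { toFun := fun h => BoundedContinuousFunction.mkOfCompact ⟨fun x => ⟪χ x, h⟫_𝕜, by fun_prop⟩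
      map_add' := fun h k => by ext x; exact inner_add_right _ _ _
      map_smul' := fun c h => by ext x; exact inner_smul_right _ _ _ }
    ‖χ‖ fun h => (BoundedContinuousFunction.norm_le (by positivity)).2 fun x =>
      (norm_inner_le_norm _ _).trans <| by gcongr; exact χ.norm_coe_le_norm x

theorem isCompactOperator_innerOp (χ : C(X, H)) : IsCompactOperator (innerOp (𝕜 := 𝕜) χ) := by
  refine (isCompactOperator_iff_isCompact_closure_image_closedBall
    (innerOp (𝕜 := 𝕜) χ : H →ₗ[𝕜] BoundedContinuousFunction X 𝕜) one_pos).2 ?_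
  refine BoundedContinuousFunction.arzela_ascoli (Metric.closedBall 0 ‖χ‖)
    (isCompact_closedBall _ _) _ ?_ fun x => ?_
  · rintro _ x ⟨h, hh, rfl⟩
    rw [mem_closedBall_zero_iff] at hh ⊢
    calc ‖⟪χ x, h⟫_𝕜‖ ≤ ‖χ x‖ * ‖h‖ := norm_inner_le_norm _ _
      _ ≤ ‖χ‖ * 1 := by gcongr; exact χ.norm_coe_le_norm x
      _ = ‖χ‖ := mul_one _
  · refine Metric.equicontinuousAt_of_continuity_modulus (fun y => ‖χ x - χ y‖) ?_ _ ?_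
    · have : Continuous fun y => ‖χ x - χ y‖ := by fun_prop
      simpa using this.tendsto x
    · refine Eventually.of_forall ?_
      rintro y ⟨_, h, hh, rfl⟩
      rw [mem_closedBall_zero_iff] at hh
      calc dist ⟪χ x, h⟫_𝕜 ⟪χ y, h⟫_𝕜 = ‖⟪χ x - χ y, h⟫_𝕜‖ := by rw [dist_eq_norm, inner_sub_left]
        _ ≤ ‖χ x - χ y‖ * ‖h‖ := norm_inner_le_norm _ _
        _ ≤ ‖χ x - χ y‖ := mul_le_of_le_one_right (norm_nonneg _) hh

end InnerOp

section MulOp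

/-- Multiplication by an essentially bounded real function, as an operator on `L²(0,1)`. -/
def mulOp (a : LInf) : L2 →L[ℂ] L2 :=
  LinearMap.mkContinuous
    { toFun := fun f => (a • f : L2)
      map_add' := fun f g => Lp.add_smul a f g
      map_smul' := fun c f => by
        refine Lp.ext ?_
        filter_upwards [Lp.coeFn_lpSMul (r := 2) a (c • f), Lp.coeFn_lpSMul (r := 2) a f,
          Lp.coeFn_smul c f, Lp.coeFn_smul c (a • f : L2)] with x h₁ h₂ h₃ h₄
        rw [RingHom.id_apply, h₁, h₄, Pi.smul_apply', Pi.smul_apply, h₃, h₂, Pi.smul_apply',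
          Pi.smul_apply, smul_comm] }
    ‖a‖ fun f => Lp.norm_smul_le a f

theorem mulOp_apply (a : LInf) (f : L2) : mulOp a f = (a • f : L2) := rfl

theorem norm_mulOp_le (a : LInf) : ‖mulOp a‖ ≤ ‖a‖ :=
  LinearMap.mkContinuous_norm_le _ (norm_nonneg _) _

theorem coeFn_mulOp (a : LInf) (f : L2) : mulOp a f =ᵐ[mu] fun x => (a x : ℂ) * f x := by
  filter_upwards [Lp.coeFn_lpSMul (r := 2) a f] with x hx
  rw [mulOp_apply, hx, Pi.smul_apply', Complex.real_smul]

theorem isSelfAdjoint_mulOp (a : LInf) : IsSelfAdjoint (mulOp a) := by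
  refine ContinuousLinearMap.isSelfAdjoint_iff_isSymmetric.2 fun f g => ?_
  simp only [ContinuousLinearMap.coe_coe, L2.inner_def]
  refine integral_congr_ae ?_
  filter_upwards [coeFn_mulOp a f, coeFn_mulOp a g] with x hf hg
  rw [hf, hg, RCLike.inner_apply, RCLike.inner_apply, map_mul, Complex.conj_ofReal]
  ring

open scoped ComplexOrder in
theorem isPositive_mulOp {a : LInf} (ha : 0 ≤ a) : (mulOp a).IsPositive := by
  refine (ContinuousLinearMap.isPositive_iff' _).2 ⟨isSelfAdjoint_mulOp a, fun f => ?_⟩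
  rw [L2.inner_def]
  refine integral_nonneg_of_ae ?_
  filter_upwards [coeFn_mulOp a f, (Lp.coeFn_nonneg a).2 ha] with x hf hx
  rw [hf, RCLike.inner_apply, map_mul, Complex.conj_ofReal, mul_left_comm, RCLike.mul_conj]
  exact mul_nonneg (Complex.zero_le_real.2 hx)
    (pow_nonneg (RCLike.ofReal_nonneg.2 (norm_nonneg _)) 2)

end MulOp

section Primitive

/-- The indicator function of `(0,x]` in `L²(0,1)`, depending continuously on `x ∈ [0,1]`. -/
def indicatorIoc : C(Icc (0 : ℝ) 1, L2) where
  toFun x := indicatorConstLp 2 (measurableSet_Ioc (a := 0) (b := (x : ℝ))) (measure_ne_top mu _) 1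
  continuous_toFun := by
    refine continuous_indicatorConstLp_set ENNReal.ofNat_ne_top fun x => ?_
    have hle (y : Icc (0 : ℝ) 1) :
        mu (symmDiff (Ioc 0 (y : ℝ)) (Ioc 0 (x : ℝ))) ≤ ENNReal.ofReal |(y : ℝ) - x| := by
      refine (Measure.restrict_apply_le _ _).trans ?_
      rw [← Real.volume_uIoc]
      exact measure_mono fun t ht => by
        simp only [mem_symmDiff, mem_Ioc, mem_uIoc] at ht ⊢
        grind
    have hlim : Continuous fun y : Icc (0 : ℝ) 1 => ENNReal.ofReal |(y : ℝ) - x| :=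
      ENNReal.continuous_ofReal.comp (by fun_prop)
    exact tendsto_of_tendsto_of_tendsto_of_le_of_le tendsto_const_nhds
      (by simpa using hlim.tendsto x) (fun _ => zero_le) hle

/-- The primitive `x ↦ ∫₀ˣ h` of `h ∈ L²(0,1)`, as a continuous function on `[0,1]`. -/
def primitive : L2 →L[ℂ] BoundedContinuousFunction (Icc (0 : ℝ) 1) ℂ := innerOp indicatorIoc

theorem mu_restrict_Ioc (x : Icc (0 : ℝ) 1) :
    mu.restrict (Ioc 0 (x : ℝ)) = volume.restrict (Ioc 0 (x : ℝ)) := by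
  rw [mu, Measure.restrict_congr_set Ioo_ae_eq_Ioc,
    Measure.restrict_restrict_of_subset (Ioc_subset_Ioc_right x.2.2)]

theorem setIntegral_mu_Ioc (f : ℝ → ℂ) (x : Icc (0 : ℝ) 1) :
    ∫ t in Ioc 0 (x : ℝ), f t ∂mu = ∫ t in (0 : ℝ)..x, f t := by
  rw [intervalIntegral.integral_of_le x.2.1, mu_restrict_Ioc]

theorem integral_mu (f : ℝ → ℂ) : ∫ t, f t ∂mu = ∫ t in (0 : ℝ)..1, f t := by
  rw [intervalIntegral.integral_of_le zero_le_one, mu, Measure.restrict_congr_set Ioo_ae_eq_Ioc]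

theorem primitive_apply (h : L2) (x : Icc (0 : ℝ) 1) :
    primitive h x = ∫ t in (0 : ℝ)..x, h t := by
  rw [← setIntegral_mu_Ioc]
  exact L2.inner_indicatorConstLp_one measurableSet_Ioc (measure_ne_top _ _) h

theorem primitive_apply_zero (h : L2) : primitive h 0 = 0 := by
  rw [primitive_apply, Set.Icc.coe_zero, intervalIntegral.integral_same]

theorem integral_congr_of_ae_mu {h k : ℝ → ℂ} (hk : h =ᵐ[mu] k) (x : Icc (0 : ℝ) 1) :
    ∫ t in (0 : ℝ)..x, h t = ∫ t in (0 : ℝ)..x, k t := by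
  rw [← setIntegral_mu_Ioc, ← setIntegral_mu_Ioc]
  exact integral_congr_ae (ae_restrict_of_ae hk)

theorem intervalIntegrable_coeFn (h : L2) : IntervalIntegrable h volume 0 1 :=
  (intervalIntegrable_iff_integrableOn_Ioo_of_le zero_le_one).2
    ((Lp.memLp h).integrable one_le_two)

/-- The inclusion of `C([0,1])` in `L²(0,1)`. -/
def toL2 : BoundedContinuousFunction (Icc (0 : ℝ) 1) ℂ →L[ℂ] L2 :=
  (BoundedContinuousFunction.toLp 2 mu ℂ).comp
    (BoundedContinuousFunction.compContinuousCLM ℂ ℂ ⟨projIcc 0 1 zero_le_one, continuous_projIcc⟩)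

theorem coeFn_toL2 (f : BoundedContinuousFunction (Icc (0 : ℝ) 1) ℂ) :
    toL2 f =ᵐ[mu] IccExtend zero_le_one f :=
  BoundedContinuousFunction.coeFn_toLp 2 mu ℂ _

theorem eq_toL2_of_ae {f : BoundedContinuousFunction (Icc (0 : ℝ) 1) ℂ} {g : L2} {F : ℝ → ℂ}
    (hg : g =ᵐ[mu] F) (hF : ∀ x : Icc (0 : ℝ) 1, F x = f x) : g = toL2 f := by
  refine Lp.ext (hg.trans ((coeFn_toL2 f).trans ?_).symm)
  filter_upwards [ae_restrict_mem measurableSet_Ioo] with x hx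
  rw [IccExtend_of_mem _ _ (Ioo_subset_Icc_self hx), ← hF]

theorem toL2_injective : Function.Injective toL2 := by
  intro f g hfg
  have h : IccExtend zero_le_one f =ᵐ[volume.restrict (Icc (0 : ℝ) 1)]
      IccExtend zero_le_one g := by
    rw [← Measure.restrict_congr_set Ioo_ae_eq_Icc]
    exact (coeFn_toL2 f).symm.trans (hfg ▸ coeFn_toL2 g)
  have := Measure.eqOn_Icc_of_ae_eq volume zero_ne_one h f.continuous.Icc_extend'.continuousOn
    g.continuous.Icc_extend'.continuousOn
  ext x
  simpa only [IccExtend_val] using this x.2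

/-- The Volterra operator on `L²(0,1)`. -/
def volterra : L2 →L[ℂ] L2 := toL2.comp primitive

theorem volterra_apply (h : L2) : volterra h = toL2 (primitive h) := rfl

theorem coeFn_volterra (h : L2) : volterra h =ᵐ[mu] fun x => ∫ t in (0 : ℝ)..x, h t := by
  refine (coeFn_toL2 _).trans ?_
  filter_upwards [ae_restrict_mem measurableSet_Ioo] with x hx
  rw [IccExtend_of_mem _ _ (Ioo_subset_Icc_self hx)]
  exact primitive_apply h _

theorem isCompactOperator_volterra : IsCompactOperator volterra :=
  (isCompactOperator_innerOp indicatorIoc).clm_comp toL2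

theorem primitive_injective : Function.Injective primitive := by
  refine (injective_iff_map_eq_zero _).2 fun h hh => Lp.ext ?_
  filter_upwards [ae_restrict_of_ae (intervalIntegrable_coeFn h).ae_hasDerivAt_integral,
    ae_restrict_mem measurableSet_Ioo, Lp.coeFn_zero ℂ 2 mu] with x hx hx01 h0
  rw [uIcc_of_le (zero_le_one' ℝ)] at hx
  rw [h0, Pi.zero_apply]
  refine (hx (Ioo_subset_Icc_self hx01) 0 ⟨le_rfl, zero_le_one⟩).unique <|
    (hasDerivAt_const x (0 : ℂ)).congr_of_eventuallyEq ?_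
  filter_upwards [isOpen_Ioo.mem_nhds hx01] with y hy
  rw [← primitive_apply h ⟨y, Ioo_subset_Icc_self hy⟩, hh, BoundedContinuousFunction.coe_zero,
    Pi.zero_apply]

/-- The constant function `1` in `L²(0,1)`. -/
def oneL2 : L2 := toL2 1

theorem inner_oneL2 (h : L2) : ⟪oneL2, h⟫_ℂ = primitive h 1 := by
  rw [L2.inner_def, primitive_apply, Icc.coe_one, ← integral_mu]
  refine integral_congr_ae ?_
  filter_upwards [coeFn_toL2 1] with x hx
  rw [oneL2, hx, IccExtend_apply, BoundedContinuousFunction.coe_one, Pi.one_apply,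
    RCLike.inner_apply, map_one, mul_one]

theorem norm_oneL2 : ‖oneL2‖ = 1 := by
  have : ⟪oneL2, oneL2⟫_ℂ = 1 := by
    rw [inner_oneL2, oneL2, primitive_apply, integral_congr_of_ae_mu (coeFn_toL2 1)]
    simp [IccExtend_apply]
  rw [norm_eq_sqrt_re_inner (𝕜 := ℂ), this, RCLike.one_re, Real.sqrt_one]

theorem integral_inner_volterra_add (k h : L2) (x : Icc (0 : ℝ) 1) :
    ∫ t in (0 : ℝ)..x, (⟪k t, volterra h t⟫_ℂ + ⟪volterra k t, h t⟫_ℂ) =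
      ⟪primitive k x, primitive h x⟫_ℂ := by
  have hint {h : L2} := (intervalIntegrable_coeFn h).mono_set
    (uIcc_subset_uIcc_left (Icc_subset_uIcc x.2))
  have hconj (y : ℝ) : ∫ t in (0 : ℝ)..y, starRingEnd ℂ (k t) =
      starRingEnd ℂ (∫ t in (0 : ℝ)..y, k t) := by
    simp only [intervalIntegral, map_sub, integral_conj]
  have hk : IntervalIntegrable (fun t => starRingEnd ℂ (k t)) volume 0 x :=
    (hint (h := k)).norm.mono_fun (by fun_prop)
      (Eventually.of_forall fun t => by simp)
  rw [RCLike.inner_apply, primitive_apply, primitive_apply, mul_comm, ← hconj,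
    ← integral_mul_primitive_add_primitive_mul hk hint]
  refine integral_congr_of_ae_mu ?_ x
  filter_upwards [coeFn_volterra h, coeFn_volterra k] with t ht kt
  rw [ht, kt, RCLike.inner_apply, RCLike.inner_apply, hconj, mul_comm, mul_comm (h t)]

theorem inner_volterra_add (k h : L2) :
    ⟪k, volterra h⟫_ℂ + ⟪volterra k, h⟫_ℂ = ⟪k, oneL2⟫_ℂ * ⟪oneL2, h⟫_ℂ := by
  rw [← inner_conj_symm k oneL2, inner_oneL2, inner_oneL2, mul_comm, ← RCLike.inner_apply,
    ← integral_inner_volterra_add, Icc.coe_one, ← integral_mu, L2.inner_def, L2.inner_def,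
    integral_add (L2.integrable_inner _ _) (L2.integrable_inner _ _)]

theorem norm_setIntegral_inner_le {α E : Type*} [MeasurableSpace α] {μ : Measure α}
    [NormedAddCommGroup E] [InnerProductSpace ℂ E] (f g : Lp E 2 μ) (s : Set α) :
    ‖∫ x in s, ⟪f x, g x⟫_ℂ ∂μ‖ ≤ ‖f‖ * ‖g‖ := by
  have : ∫ x in s, ⟪f x, g x⟫_ℂ ∂μ =
      ⟪LpToLpRestrictCLM α E ℂ μ 2 s f, LpToLpRestrictCLM α E ℂ μ 2 s g⟫_ℂ := by
    rw [L2.inner_def]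
    refine integral_congr_ae ?_
    filter_upwards [LpToLpRestrictCLM_coeFn ℂ s f, LpToLpRestrictCLM_coeFn ℂ s g] with x hf hg
    rw [hf, hg]
  rw [this]
  exact (norm_inner_le_norm _ _).trans <| mul_le_mul (norm_Lp_toLp_restrict_le s f)
    (norm_Lp_toLp_restrict_le s g) (norm_nonneg _) (norm_nonneg _)

theorem norm_primitive_apply_sq_le (d : L2) (x : Icc (0 : ℝ) 1) :
    ‖primitive d x‖ ^ 2 ≤ 2 * (‖d‖ * ‖volterra d‖) := by
  calc ‖primitive d x‖ ^ 2 = ‖⟪primitive d x, primitive d x⟫_ℂ‖ := by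
        rw [RCLike.inner_apply, norm_mul, RCLike.norm_conj, sq]
    _ = ‖(∫ t in Ioc 0 (x : ℝ), ⟪d t, volterra d t⟫_ℂ ∂mu) +
          ∫ t in Ioc 0 (x : ℝ), ⟪volterra d t, d t⟫_ℂ ∂mu‖ := by
        rw [← integral_inner_volterra_add, ← setIntegral_mu_Ioc,
          integral_add (L2.integrable_inner _ _).restrict (L2.integrable_inner _ _).restrict]
    _ ≤ ‖d‖ * ‖volterra d‖ + ‖volterra d‖ * ‖d‖ :=
        norm_add_le_of_le (norm_setIntegral_inner_le _ _ _) (norm_setIntegral_inner_le _ _ _)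
    _ = 2 * (‖d‖ * ‖volterra d‖) := by ring

end Primitive

section DirichletProblem

variable {q : ℝ → ℝ} {Q : LInf} {f g f' g' : L2}

theorem primitive_toL2_apply (E : BoundedContinuousFunction (Icc (0 : ℝ) 1) ℂ)
    (x : Icc (0 : ℝ) 1) :
    primitive (toL2 E) x = ∫ t in (0 : ℝ)..x, IccExtend zero_le_one E t := by
  rw [primitive_apply, integral_congr_of_ae_mu (coeFn_toL2 E)]

theorem primitive_toL2_eq_of_hasDerivWithinAt {E : BoundedContinuousFunction (Icc (0 : ℝ) 1) ℂ}
    {F : ℝ → ℂ} (hF : ∀ x : Icc (0 : ℝ) 1, HasDerivWithinAt F (E x) (Icc 0 1) x) (hF₀ : F 0 = 0)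
    (x : Icc (0 : ℝ) 1) : primitive (toL2 E) x = F x := by
  have hsub : Icc (0 : ℝ) x ⊆ Icc 0 1 := Icc_subset_Icc_right x.2.2
  rw [primitive_toL2_apply, intervalIntegral.integral_eq_sub_of_hasDerivAt_of_le x.2.1
    (fun y hy => ((hF ⟨y, hsub hy⟩).continuousWithinAt).mono hsub) (fun y hy => ?_)
    (E.continuous.Icc_extend'.intervalIntegrable 0 x), hF₀, sub_zero]
  have hy' := hsub (Ioo_subset_Icc_self hy)
  rw [IccExtend_of_mem _ _ hy']
  exact (hF ⟨y, hy'⟩).hasDerivAt (Icc_mem_nhds hy.1 (hy.2.trans_le x.2.2))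

theorem coeFn_mulOp_sub (hQ : Q =ᵐ[mu] q) {F : ℝ → ℂ} (hF : f =ᵐ[mu] F) :
    mulOp Q f - g =ᵐ[mu] fun t => (q t : ℂ) * F t - g t := by
  filter_upwards [hF, Lp.coeFn_sub (mulOp Q f) g, coeFn_mulOp Q f, hQ] with t hf hsub hmul hq
  rw [hsub, Pi.sub_apply, hmul, hf, hq]

theorem IsDirichletSL.exists_eq_volterra (hQ : Q =ᵐ[mu] q) (h : IsDirichletSL q f g) :
    ∃ κ : ℂ, f = volterra (κ • oneL2 + volterra (mulOp Q f - g)) ∧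
      ⟪oneL2, κ • oneL2 + volterra (mulOp Q f - g)⟫_ℂ = 0 := by
  obtain ⟨F, D, hfF, hFD, hD, hF₀, hF₁⟩ := h
  let E := D 0 • 1 + primitive (mulOp Q f - g)
  have hE : D 0 • oneL2 + volterra (mulOp Q f - g) = toL2 E := by
    rw [map_add, map_smul, oneL2, volterra_apply]
  have hED (x : Icc (0 : ℝ) 1) : E x = D x := by
    rw [hD x x.2, ← integral_congr_of_ae_mu (coeFn_mulOp_sub hQ hfF) x, ← primitive_apply]
    simp [E]
  have hEF := primitive_toL2_eq_of_hasDerivWithinAt (E := E)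
    (fun x => (hED x).symm ▸ hFD x x.2) hF₀
  refine ⟨D 0, ?_, ?_⟩
  · rw [hE, volterra_apply]
    exact eq_toL2_of_ae hfF fun x => (hEF x).symm
  · rw [hE, inner_oneL2, hEF, Icc.coe_one, hF₁]

theorem isDirichletSL_of_eq_volterra (hQ : Q =ᵐ[mu] q) {κ : ℂ}
    (hf : f = volterra (κ • oneL2 + volterra (mulOp Q f - g)))
    (hκ : ⟪oneL2, κ • oneL2 + volterra (mulOp Q f - g)⟫_ℂ = 0) : IsDirichletSL q f g := by
  let E := κ • 1 + primitive (mulOp Q f - g)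
  have hE : κ • oneL2 + volterra (mulOp Q f - g) = toL2 E := by
    rw [map_add, map_smul, oneL2, volterra_apply]
  rw [hE] at hf hκ
  have hEx (x : Icc (0 : ℝ) 1) : E x = κ + primitive (mulOp Q f - g) x := by simp [E]
  have hfF : f =ᵐ[mu] fun x => ∫ t in (0 : ℝ)..x, IccExtend zero_le_one E t := by
    rw [hf]
    refine (coeFn_volterra _).trans ?_
    filter_upwards [ae_restrict_mem measurableSet_Ioo] with x hx
    exact integral_congr_of_ae_mu (coeFn_toL2 E) ⟨x, Ioo_subset_Icc_self hx⟩
  refine ⟨_, IccExtend zero_le_one E, hfF, fun x _ =>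
    (E.continuous.Icc_extend'.integral_hasStrictDerivAt 0 x).hasDerivAt.hasDerivWithinAt,
    fun x hx => ?_, intervalIntegral.integral_same, ?_⟩
  · rw [← integral_congr_of_ae_mu (coeFn_mulOp_sub hQ hfF) ⟨x, hx⟩, ← primitive_apply,
      IccExtend_of_mem _ _ hx, IccExtend_left, hEx, hEx]
    exact congrArg (· + _) ((congrArg (κ + ·) (primitive_apply_zero _)).trans (add_zero κ)).symm
  · rw [← hκ, inner_oneL2, primitive_toL2_apply, Icc.coe_one]

/-- The Volterra operator restricted to the functions of mean zero, on which integration from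
either endpoint gives the same primitive: it takes the derivative of a function vanishing at both
endpoints to the function. -/
def dirichletPrimitive : L2 →L[ℂ] L2 := volterra ∘L (ℂ ∙ oneL2)ᗮ.starProjection

theorem dirichletPrimitive_apply_of_inner_eq_zero {d : L2} (hd : ⟪oneL2, d⟫_ℂ = 0) :
    dirichletPrimitive d = volterra d := by
  rw [dirichletPrimitive, ContinuousLinearMap.comp_apply, Submodule.starProjection_eq_self_iff.2
    (Submodule.mem_orthogonal_singleton_iff_inner_right.2 hd)]

theorem isCompactOperator_dirichletPrimitive : IsCompactOperator dirichletPrimitive :=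
  isCompactOperator_volterra.comp_clm _

theorem adjoint_dirichletPrimitive_apply (h : L2) :
    dirichletPrimitive.adjoint h = -(ℂ ∙ oneL2)ᗮ.starProjection (volterra h) := by
  refine ext_inner_right ℂ fun k => ?_
  have := inner_volterra_add h ((ℂ ∙ oneL2)ᗮ.starProjection k)
  rw [Submodule.mem_orthogonal_singleton_iff_inner_right.1
    (Submodule.starProjection_apply_mem _ k), mul_zero] at this
  rw [ContinuousLinearMap.adjoint_inner_left, dirichletPrimitive, ContinuousLinearMap.comp_apply,
    inner_neg_left, Submodule.inner_starProjection_left_eq_right]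
  exact eq_neg_of_add_eq_zero_left this

theorem adjoint_dirichletPrimitive_eq (h : L2) :
    dirichletPrimitive.adjoint h = ⟪oneL2, volterra h⟫_ℂ • oneL2 - volterra h := by
  rw [adjoint_dirichletPrimitive_apply, Submodule.starProjection_orthogonal_val,
    Submodule.starProjection_unit_singleton ℂ norm_oneL2, neg_sub]

theorem inner_oneL2_adjoint_dirichletPrimitive (h : L2) :
    ⟪oneL2, dirichletPrimitive.adjoint h⟫_ℂ = 0 := by
  rw [adjoint_dirichletPrimitive_apply, inner_neg_right,
    Submodule.mem_orthogonal_singleton_iff_inner_right.1 (Submodule.starProjection_apply_mem _ _),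
    neg_zero]

theorem adjoint_dirichletPrimitive_injective :
    Function.Injective dirichletPrimitive.adjoint := by
  refine (injective_iff_map_eq_zero _).2 fun h hh => primitive_injective ?_
  have hc : primitive h = ⟪oneL2, volterra h⟫_ℂ • 1 := toL2_injective <| by
    rw [map_smul, ← oneL2, ← volterra_apply, ← sub_eq_zero, ← neg_sub,
      ← adjoint_dirichletPrimitive_eq, hh, neg_zero]
  have h₀ : ⟪oneL2, volterra h⟫_ℂ = 0 := by
    simpa [primitive_apply_zero] using (DFunLike.congr_fun hc 0).symm
  rw [hc, h₀, zero_smul, map_zero]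

theorem isDirichletSL_iff (hQ : Q =ᵐ[mu] q) : IsDirichletSL q f g ↔
    f = dirichletPrimitive (dirichletPrimitive.adjoint (g - mulOp Q f)) := by
  refine ⟨fun h => ?_, fun h => ?_⟩
  · obtain ⟨κ, hf, hκ⟩ := h.exists_eq_volterra hQ
    have hd : dirichletPrimitive.adjoint (g - mulOp Q f) =
        κ • oneL2 + volterra (mulOp Q f - g) := by
      rw [inner_add_right, inner_smul_right, inner_self_eq_one_of_norm_eq_one norm_oneL2,
        mul_one] at hκ
      rw [adjoint_dirichletPrimitive_eq, ← neg_sub (mulOp Q f), map_neg, inner_neg_right,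
        eq_neg_of_add_eq_zero_left hκ, sub_neg_eq_add]
    rw [hd, dirichletPrimitive_apply_of_inner_eq_zero hκ, ← hf]
  · have hd := inner_oneL2_adjoint_dirichletPrimitive (g - mulOp Q f)
    rw [dirichletPrimitive_apply_of_inner_eq_zero hd] at h
    rw [adjoint_dirichletPrimitive_eq, sub_eq_add_neg, ← map_neg, neg_sub] at h hd
    exact isDirichletSL_of_eq_volterra hQ h hd

theorem IsDirichletSL.inner_symm (hQ : Q =ᵐ[mu] q) (h : IsDirichletSL q f g)
    (h' : IsDirichletSL q f' g') : ⟪g, f'⟫_ℂ = ⟪f, g'⟫_ℂ := by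
  have hf := (isDirichletSL_iff hQ).1 h
  have hf' := (isDirichletSL_iff hQ).1 h'
  have key : ⟪g - mulOp Q f, f'⟫_ℂ = ⟪f, g' - mulOp Q f'⟫_ℂ := by
    conv_lhs => rw [hf', ← ContinuousLinearMap.adjoint_inner_left]
    conv_rhs => rw [hf, ← ContinuousLinearMap.adjoint_inner_right]
  rw [inner_sub_left, inner_sub_right,
    (isSelfAdjoint_mulOp Q).isSymmetric.apply_clm f f'] at key
  exact sub_left_inj.1 key

end DirichletProblem

section CompactOperators

universe u v
variable {ι K : Type*} {𝕜 : Type u} {H : Type v} [RCLike 𝕜]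
  [NormedAddCommGroup H] [InnerProductSpace 𝕜 H] [NormedAddCommGroup K] [InnerProductSpace 𝕜 K]

theorem mem_orthogonal_of_forall_inner_hilbertBasis {U : Submodule 𝕜 H} [CompleteSpace U]
    (b : HilbertBasis ι 𝕜 U) {x : H} (hx : ∀ i, ⟪(b i : H), x⟫_𝕜 = 0) : x ∈ Uᗮ := by
  rw [← Submodule.orthogonalProjectionOnto_eq_zero_iff]
  refine ext_inner_hilbertBasis b fun i => ?_
  rw [Submodule.inner_orthogonalProjectionOnto_eq_of_mem_left, hx, inner_zero_right]

theorem finite_setOf_le_norm_of_orthonormal {R : H →L[𝕜] H} (hR : IsCompactOperator R)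
    {v : ι → H} (hv : Orthonormal 𝕜 v) {μ : ι → 𝕜} (hμ : ∀ i, R (v i) = μ i • v i) {ε : ℝ}
    (hε : 0 < ε) : {i | ε ≤ ‖μ i‖}.Finite := by
  obtain ⟨t, ht, hcover⟩ := Metric.totallyBounded_iff.1
    (hR.isCompact_closure_image_closedBall (f := (R : H →ₗ[𝕜] H)) 1).totallyBounded (ε / 2)
    (by positivity)
  have hmem (i : ι) : ∃ y ∈ t, R (v i) ∈ Metric.ball y (ε / 2) := by
    simpa using hcover (subset_closure ⟨v i, by simp [hv.1 i], rfl⟩)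
  choose c hct hc using hmem
  refine Set.Finite.of_injOn (fun i _ => hct i) (fun i hi j _ hij => ?_) ht
  by_contra hne
  have hlt : ‖μ i • v i - μ j • v j‖ < ε := by
    rw [← hμ, ← hμ, ← dist_eq_norm]
    have := dist_triangle_right (R (v i)) (R (v j)) (c i)
    linarith [Metric.mem_ball.1 (hc i), hij ▸ Metric.mem_ball.1 (hc j)]
  have hsq : ‖μ i • v i - μ j • v j‖ ^ 2 = ‖μ i‖ ^ 2 + ‖μ j‖ ^ 2 := by
    rw [@norm_sub_sq 𝕜, inner_smul_left, inner_smul_right, hv.2 hne, norm_smul, norm_smul, hv.1,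
      hv.1]
    simp
  refine hlt.not_ge (le_of_sq_le_sq ?_ (norm_nonneg _))
  rw [hsq]
  exact (pow_le_pow_left₀ hε.le hi 2).trans (le_add_of_nonneg_right (sq_nonneg _))

variable [CompleteSpace H]

theorem exists_hilbertBasis_apply_eq_smul {R : H →L[𝕜] H} (hR : IsCompactOperator R)
    (hR' : R.IsSymmetric) :
    ∃ (ι : Type (max u v)) (b : HilbertBasis ι 𝕜 H) (μ : ι → 𝕜), ∀ i, R (b i) = μ i • b i := by
  have hE (μ : 𝕜) : CompleteSpace (Module.End.eigenspace (R : Module.End 𝕜 H) μ) := by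
    refine IsClosed.completeSpace_coe (hs := ?_)
    convert isClosed_eq R.continuous (continuous_const_smul μ)
    ext x
    exact Module.End.mem_eigenspace_iff
  choose w b _ using fun μ =>
    exists_hilbertBasis 𝕜 (Module.End.eigenspace (R : Module.End 𝕜 H) μ)
  have hon : Orthonormal 𝕜 fun a : Σ μ, w μ => (b a.1 a.2 : H) :=
    hR'.orthogonalFamily_eigenspaces.orthonormal_sigma_orthonormal fun μ => (b μ).orthonormal
  have hbot : (Submodule.span 𝕜 (range fun a : Σ μ, w μ => (b a.1 a.2 : H)))ᗮ = ⊥ := by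
    rw [eq_bot_iff, ← ContinuousLinearMap.orthogonalComplement_iSup_eigenspaces_eq_bot hR hR',
      ← Submodule.iInf_orthogonal]
    refine fun x hx => Submodule.mem_iInf _ |>.2 fun μ =>
      mem_orthogonal_of_forall_inner_hilbertBasis (b μ) fun i => ?_
    exact (Submodule.mem_orthogonal _ _).1 hx _ (Submodule.subset_span ⟨⟨μ, i⟩, rfl⟩)
  refine ⟨_, HilbertBasis.mkOfOrthogonalEqBot hon hbot, fun a => a.1, fun a => ?_⟩
  rw [HilbertBasis.coe_mkOfOrthogonalEqBot]
  exact Module.End.mem_eigenspace_iff.1 (b a.1 a.2).2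

theorem exists_hilbertBasis_apply_eq_pos_smul {R : H →L[𝕜] H} (hR : IsCompactOperator R)
    (hR' : R.IsPositive) (hinj : Function.Injective R) :
    ∃ (ι : Type (max u v)) (b : HilbertBasis ι 𝕜 H) (μ : ι → ℝ),
      (∀ i, 0 < μ i ∧ R (b i) = (μ i : 𝕜) • b i) ∧ ∀ ε > 0, {i | ε ≤ μ i}.Finite := by
  obtain ⟨ι, b, μ, hμ⟩ := exists_hilbertBasis_apply_eq_smul hR hR'.isSymmetric
  have hμr (i : ι) : ((RCLike.re (μ i) : ℝ) : 𝕜) = μ i :=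
    RCLike.conj_eq_iff_re.1 (hR'.isSymmetric.conj_eigenvalue_eq_self
      (Module.End.hasEigenvalue_of_hasEigenvector
        ⟨Module.End.mem_eigenspace_iff.2 (hμ i), b.orthonormal.ne_zero i⟩))
  have hpos (i : ι) : 0 < RCLike.re (μ i) := by
    refine lt_of_le_of_ne ?_ fun h => b.orthonormal.ne_zero i (hinj ?_)
    · simpa [hμ, inner_smul_right, b.orthonormal.1] using hR'.re_inner_nonneg_right (b i)
    · rw [hμ, ← hμr, ← h, RCLike.ofReal_zero, zero_smul, map_zero]
  refine ⟨ι, b, fun i => RCLike.re (μ i), fun i => ⟨hpos i, by rw [hμr, hμ]⟩, fun ε hε => ?_⟩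
  refine (finite_setOf_le_norm_of_orthonormal hR b.orthonormal hμ hε).subset fun i hi => ?_
  exact le_trans hi (RCLike.re_le_norm _)

theorem isPositive_add_norm_smul_one {T : H →L[𝕜] H} (hT : IsSelfAdjoint T) :
    (T + (‖T‖ : 𝕜) • 1).IsPositive := by
  refine ⟨?_, fun x => ?_⟩
  · refine (hT.add (IsSelfAdjoint.smul ?_ (.one _))).isSymmetric
    exact RCLike.conj_ofReal _
  · have h := (abs_le.1 ((RCLike.abs_re_le_norm _).trans (norm_inner_le_norm (𝕜 := 𝕜) (T x) x))).1
    have h' := mul_le_mul_of_nonneg_right (T.le_opNorm x) (norm_nonneg x)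
    rw [ContinuousLinearMap.reApplyInnerSelf, add_apply, smul_apply, one_apply_eq_self,
      inner_add_left, inner_smul_left, RCLike.conj_ofReal, map_add, RCLike.re_ofReal_mul,
      inner_self_eq_norm_sq]
    nlinarith

theorem exists_isPositive_apply_add {A : H →L[𝕜] H} (hA : A.IsPositive) :
    ∃ S : H →L[𝕜] H, S.IsPositive ∧ ∀ x, S x + A (S x) = x := by
  have hpos := ContinuousLinearMap.isPositive_one.add hA
  obtain ⟨S, hS⟩ : ∃ S : H →L[𝕜] H, (1 + A) * S = 1 := by
    refine IsUnit.exists_right_inv <|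
      ContinuousLinearMap.isUnit_of_forall_le_norm_inner_map _ one_pos fun x => ?_
    refine le_trans ?_ (RCLike.re_le_norm _)
    rw [add_apply, inner_add_left, map_add, one_apply_eq_self,
      inner_self_eq_norm_sq, NNReal.coe_one, mul_one]
    exact le_add_of_nonneg_right (hA.re_inner_nonneg_left x)
  have hSx (x : H) : (1 + A) (S x) = x := DFunLike.congr_fun hS x
  refine ⟨S, ⟨fun x y => ?_, fun x => ?_⟩, hSx⟩
  · have := hpos.isSymmetric (S x) (S y)
    simpa only [ContinuousLinearMap.coe_coe, hSx] using this.symm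
  · have := hpos.re_inner_nonneg_right (S x)
    rwa [hSx] at this

theorem exists_isCompactOperator_resolvent [CompleteSpace K] {J : K →L[𝕜] H}
    (hJ : IsCompactOperator J) (hJ' : Function.Injective J.adjoint) {m : H →L[𝕜] H}
    (hm : m.IsPositive) : ∃ R : H →L[𝕜] H, IsCompactOperator R ∧ R.IsPositive ∧
      Function.Injective R ∧ ∀ h, R h = J (J.adjoint (h - m (R h))) := by
  obtain ⟨S, hS, hSx⟩ := exists_isPositive_apply_add (hm.adjoint_conj J)
  have hR (h : H) : J (S (J.adjoint h)) = J (J.adjoint (h - m (J (S (J.adjoint h))))) := by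
    rw [map_sub J.adjoint]
    exact congrArg J (eq_sub_of_add_eq (hSx (J.adjoint h)))
  refine ⟨J ∘L S ∘L J.adjoint, hJ.comp_clm _, hS.conj_adjoint J, ?_, hR⟩
  refine (injective_iff_map_eq_zero _).2 fun h hh => hJ' ?_
  have hJJ : J (J.adjoint h) = 0 := by
    have := hR h
    rwa [show J (S (J.adjoint h)) = 0 from hh, map_zero, sub_zero, eq_comm] at this
  rw [map_zero, ← inner_self_eq_zero (𝕜 := 𝕜), ContinuousLinearMap.adjoint_inner_left, hJJ,
    inner_zero_right]

end CompactOperators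

section Eigenbasis

variable {q : ℝ → ℝ} {Q : LInf}

theorem exists_resolvent_isDirichletSL (hQ : Q =ᵐ[mu] q) :
    ∃ R : L2 →L[ℂ] L2, IsCompactOperator R ∧ R.IsPositive ∧ Function.Injective R ∧
      ∀ h, IsDirichletSL q (R h) (h - (‖mulOp Q‖ : ℂ) • R h) := by
  obtain ⟨R, hR, hRpos, hRinj, hRh⟩ := exists_isCompactOperator_resolvent
    isCompactOperator_dirichletPrimitive adjoint_dirichletPrimitive_injective
    (isPositive_add_norm_smul_one (isSelfAdjoint_mulOp Q))
  refine ⟨R, hR, hRpos, hRinj, fun h => (isDirichletSL_iff hQ).2 ((hRh h).trans ?_)⟩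
  rw [sub_sub, add_comm]
  rfl

theorem IsDirichletSL.smul (hQ : Q =ᵐ[mu] q) {f g : L2} (c : ℂ) (h : IsDirichletSL q f g) :
    IsDirichletSL q (c • f) (c • g) := by
  rw [isDirichletSL_iff hQ] at h ⊢
  rw [map_smul (mulOp Q), ← smul_sub, map_smul, map_smul, ← h]

theorem exists_hilbertBasis_isEigenpair (hQ : Q =ᵐ[mu] q) :
    ∃ (ι : Type) (b : HilbertBasis ι ℂ L2) (lam : ι → ℝ),
      (∀ i, IsEigenpair q (lam i) (b i)) ∧ ∀ Λ, {i | lam i ≤ Λ}.Finite := by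
  obtain ⟨R, hR, hRpos, hRinj, hRh⟩ := exists_resolvent_isDirichletSL hQ
  obtain ⟨ι, b, μ, hμ, hfin⟩ := exists_hilbertBasis_apply_eq_pos_smul hR hRpos hRinj
  refine ⟨ι, b, fun i => (μ i)⁻¹ - ‖mulOp Q‖, fun i => ⟨b.orthonormal.ne_zero i, ?_⟩, fun Λ => ?_⟩
  · have hRb : R (b i) = (μ i : ℂ) • b i := (hμ i).2
    have hμ₀ : (μ i : ℂ) ≠ 0 := Complex.ofReal_ne_zero.2 (hμ i).1.ne'
    have h := (hRh (b i)).smul hQ (μ i : ℂ)⁻¹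
    rw [hRb, smul_sub, smul_comm (‖mulOp Q‖ : ℂ), inv_smul_smul₀ hμ₀, inv_smul_smul₀ hμ₀,
      ← sub_smul] at h
    exact_mod_cast h
  · refine (hfin (|Λ| + ‖mulOp Q‖ + 1)⁻¹ (by positivity)).subset fun i hi => ?_
    have hle : (μ i)⁻¹ - ‖mulOp Q‖ ≤ Λ := hi
    exact inv_le_of_inv_le₀ (hμ i).1 (by linarith [le_abs_self Λ])

end Eigenbasis

section Spectrum

variable {q : ℝ → ℝ} {Q : LInf} {ι : Type*} {b : HilbertBasis ι ℂ L2} {lam : ι → ℝ}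

theorem exists_pos_forall_le {α : Type*} {f : α → ℝ} (hf : ∀ i, 0 < f i)
    (hfin : ∀ R, {i | f i ≤ R}.Finite) : ∃ δ, 0 < δ ∧ ∀ i, δ ≤ f i := by
  obtain hα | ⟨⟨i₀⟩⟩ := isEmpty_or_nonempty α
  · exact ⟨1, one_pos, fun i => hα.elim i⟩
  · obtain ⟨i₁, hi₁, hmin⟩ :=
      Set.exists_min_image {i | f i ≤ f i₀} f (hfin (f i₀)) ⟨i₀, le_refl (f i₀)⟩
    refine ⟨f i₁, hf i₁, fun i => ?_⟩
    obtain hi | hi := le_total (f i) (f i₀)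
    · exact hmin i hi
    · exact le_trans hi₁ hi

theorem isFracPow_iff (hQ : Q =ᵐ[mu] q) (hb : ∀ i, IsEigenpair q (lam i) (b i)) {r : ℝ}
    {f g : L2} : IsFracPow q r f g ↔ ∀ i, ⟪b i, g⟫_ℂ = ((lam i ^ r : ℝ) : ℂ) * ⟪b i, f⟫_ℂ := by
  refine ⟨fun h i => h (lam i) (b i) (hb i), fun h l φ hφ => ?_⟩
  have hterm (i : ι) : ⟪φ, b i⟫_ℂ * ⟪b i, g⟫_ℂ =
      ((l ^ r : ℝ) : ℂ) * (⟪φ, b i⟫_ℂ * ⟪b i, f⟫_ℂ) := by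
    obtain rfl | hl := eq_or_ne l (lam i)
    · rw [h i, mul_left_comm]
    · have hsymm := hφ.2.inner_symm hQ (hb i).2
      rw [inner_smul_left, inner_smul_right, Complex.conj_ofReal] at hsymm
      have hφb : ⟪φ, b i⟫_ℂ = 0 := by
        by_contra h₀
        exact hl (Complex.ofReal_injective (mul_right_cancel₀ h₀ hsymm))
      rw [hφb, zero_mul, zero_mul, mul_zero]
  refine (b.hasSum_inner_mul_inner φ g).unique ?_
  simp only [hterm]
  exact (b.hasSum_inner_mul_inner φ f).mul_left _

end Spectrum

section SobolevEmbedding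

variable {𝕜 H X ι : Type*} [RCLike 𝕜] [NormedAddCommGroup H] [InnerProductSpace 𝕜 H]
  [NormedAddCommGroup X] [NormedSpace 𝕜 X]

theorem norm_sum_inner_smul_le (b : HilbertBasis ι 𝕜 H) {u w : H} {C : ℝ} (hC : 0 ≤ C)
    (s : Finset ι) (h : ∀ i ∈ s, ‖⟪b i, u⟫_𝕜‖ ≤ C * ‖⟪b i, w⟫_𝕜‖) :
    ‖∑ i ∈ s, ⟪b i, u⟫_𝕜 • b i‖ ≤ C * ‖w‖ := by
  classical
  refine norm_le_mul_of_forall_norm_inner_le b hC fun i => ?_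
  simp only [inner_sum, inner_smul_right, orthonormal_iff_ite.1 b.orthonormal, mul_ite, mul_one,
    mul_zero, Finset.sum_ite_eq]
  split_ifs with hi
  · exact h i hi
  · rw [norm_zero]; positivity

theorem hasSum_blocks_eq (b : HilbertBasis ι 𝕜 H) (j : X →L[𝕜] H) {e : ι → X}
    (he : ∀ i, j (e i) = b i) {ℓ : ι → ℕ} {S : ℕ → Finset ι} (hS : ∀ i n, i ∈ S n ↔ ℓ i = n)
    {u : H} {G : X} (hG : HasSum (fun n => ∑ i ∈ S n, ⟪b i, u⟫_𝕜 • e i) G) : j G = u := by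
  classical
  refine ext_inner_hilbertBasis b fun i => (hG.mapL ((innerSL 𝕜 (b i)).comp j)).unique ?_
  convert! hasSum_ite_eq (ℓ i) ⟪b i, u⟫_𝕜 using 2 with n
  simp only [ContinuousLinearMap.comp_apply, map_sum, map_smul, he, innerSL_apply_apply,
    orthonormal_iff_ite.1 b.orthonormal, smul_eq_mul, mul_ite, mul_one, mul_zero,
    Finset.sum_ite_eq, hS]
  simp only [eq_comm]

/-- The dyadic blocks `2 ^ n ≤ ρ i < 2 ^ (n + 1)` of the expansion of `u` decay geometrically in
`X`, by a factor `2 ^ (θ - σ)`. -/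
theorem exists_mem_closure_span_apply_eq [CompleteSpace X] (b : HilbertBasis ι 𝕜 H)
    (j : X →L[𝕜] H) {e : ι → X} (he : ∀ i, j (e i) = b i) {ρ : ι → ℝ} (hρ : ∀ i, 1 ≤ ρ i)
    (hfin : ∀ R, {i | ρ i ≤ R}.Finite) {M θ σ : ℝ} (hM : 0 ≤ M) (hσ : 0 ≤ σ) (hθσ : θ < σ)
    (hX : ∀ (s : Finset ι) (R : ℝ), 1 ≤ R → (∀ i ∈ s, ρ i ≤ R) → ∀ a : ι → 𝕜,
      ‖∑ i ∈ s, a i • e i‖ ≤ M * R ^ θ * ‖∑ i ∈ s, a i • b i‖)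
    {u w : H} (huw : ∀ i, ρ i ^ σ * ‖⟪b i, u⟫_𝕜‖ ≤ ‖⟪b i, w⟫_𝕜‖) :
    ∃ G ∈ (Submodule.span 𝕜 (range e)).topologicalClosure, j G = u := by
  choose ℓ hℓ hℓ' using fun i => exists_nat_pow_near (hρ i) one_lt_two
  have hSfin (n : ℕ) : {i | ℓ i = n}.Finite :=
    (hfin (2 ^ (n + 1))).subset fun i (hi : ℓ i = n) => hi ▸ (hℓ' i).le
  let S (n : ℕ) : Finset ι := (hSfin n).toFinset
  have hS (i : ι) (n : ℕ) : i ∈ S n ↔ ℓ i = n := (hSfin n).mem_toFinset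
  have hcoeff (n : ℕ) : ‖∑ i ∈ S n, ⟪b i, u⟫_𝕜 • b i‖ ≤ (((2 : ℝ) ^ n) ^ σ)⁻¹ * ‖w‖ := by
    refine norm_sum_inner_smul_le b (by positivity) _ fun i hi => ?_
    rw [← div_eq_inv_mul, le_div_iff₀' (by positivity)]
    refine le_trans ?_ (huw i)
    gcongr
    exact (hS i n).1 hi ▸ hℓ i
  have hblock (n : ℕ) : ‖∑ i ∈ S n, ⟪b i, u⟫_𝕜 • e i‖ ≤
      M * 2 ^ θ * ‖w‖ * ((2 : ℝ) ^ (θ - σ)) ^ n := by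
    calc ‖∑ i ∈ S n, ⟪b i, u⟫_𝕜 • e i‖
        ≤ M * ((2 : ℝ) ^ (n + 1)) ^ θ * ‖∑ i ∈ S n, ⟪b i, u⟫_𝕜 • b i‖ :=
          hX _ _ (one_le_pow₀ one_le_two) (fun i hi => (hS i n).1 hi ▸ (hℓ' i).le) _
      _ ≤ M * ((2 : ℝ) ^ (n + 1)) ^ θ * ((((2 : ℝ) ^ n) ^ σ)⁻¹ * ‖w‖) := by
          gcongr; exact hcoeff n
      _ = M * 2 ^ θ * ‖w‖ * ((2 : ℝ) ^ (θ - σ)) ^ n := by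
          rw [pow_succ, Real.mul_rpow (by positivity) two_pos.le, Real.rpow_sub two_pos, div_pow,
            Real.rpow_pow_comm two_pos.le, Real.rpow_pow_comm two_pos.le]
          ring
  obtain ⟨G, hG⟩ := Summable.of_norm_bounded ((summable_geometric_of_lt_one (by positivity)
    (Real.rpow_lt_one_of_one_lt_of_neg one_lt_two (sub_neg.2 hθσ))).mul_left _) hblock
  refine ⟨G, ?_, hasSum_blocks_eq b j he hS hG⟩
  refine isClosed_closure.mem_of_tendsto hG (Eventually.of_forall fun t => subset_closure ?_)
  exact Submodule.sum_mem _ fun n _ => Submodule.sum_mem _ fun i _ =>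
    Submodule.smul_mem _ _ (Submodule.subset_span (mem_range_self i))

end SobolevEmbedding

section Endpoints

theorem re_inner_sum_smul_le {𝕜 H ι : Type*} [RCLike 𝕜] [NormedAddCommGroup H]
    [InnerProductSpace 𝕜 H] {v : ι → H} (hv : Orthonormal 𝕜 v) {lam : ι → ℝ} {s : Finset ι} {Λ : ℝ}
    (hs : ∀ i ∈ s, lam i ≤ Λ) (a : ι → 𝕜) :
    RCLike.re ⟪∑ i ∈ s, a i • (lam i : 𝕜) • v i, ∑ i ∈ s, a i • v i⟫_𝕜 ≤
      Λ * ‖∑ i ∈ s, a i • v i‖ ^ 2 := by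
  have hterm (i : ι) (c : ℝ) :
      RCLike.re (starRingEnd 𝕜 (a i * (c : 𝕜)) * a i) = c * ‖a i‖ ^ 2 := by
    rw [map_mul (starRingEnd 𝕜), RCLike.conj_ofReal, mul_right_comm, RCLike.conj_mul]
    exact_mod_cast mul_comm _ _
  have hone (i : ι) : RCLike.re (starRingEnd 𝕜 (a i) * a i) = ‖a i‖ ^ 2 := by
    rw [RCLike.conj_mul]
    exact_mod_cast RCLike.ofReal_re (K := 𝕜) _
  rw [← inner_self_eq_norm_sq (𝕜 := 𝕜), hv.inner_sum, map_sum, Finset.mul_sum]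
  simp only [smul_smul]
  rw [hv.inner_sum, map_sum]
  refine Finset.sum_le_sum fun i hi => ?_
  rw [hterm, hone]
  gcongr
  exact hs i hi

variable {q : ℝ → ℝ} {Q : LInf} {f g : L2}

theorem IsDirichletSL.norm_adjoint_dirichletPrimitive_sq (hQ : Q =ᵐ[mu] q)
    (h : IsDirichletSL q f g) :
    ‖dirichletPrimitive.adjoint (g - mulOp Q f)‖ ^ 2 = RCLike.re ⟪g - mulOp Q f, f⟫_ℂ := by
  rw [← inner_self_eq_norm_sq (𝕜 := ℂ), ContinuousLinearMap.adjoint_inner_left,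
    ← (isDirichletSL_iff hQ).1 h]

theorem IsDirichletSL.toL2_primitive (hQ : Q =ᵐ[mu] q) (h : IsDirichletSL q f g) :
    toL2 (primitive (dirichletPrimitive.adjoint (g - mulOp Q f))) = f := by
  rw [← volterra_apply, ← dirichletPrimitive_apply_of_inner_eq_zero
    (inner_oneL2_adjoint_dirichletPrimitive _), ← (isDirichletSL_iff hQ).1 h]

theorem IsDirichletSL.norm_primitive_sq_le (hQ : Q =ᵐ[mu] q) (h : IsDirichletSL q f g)
    {Λ : ℝ} (hΛ : 0 ≤ Λ) (hfg : RCLike.re ⟪g, f⟫_ℂ ≤ Λ * ‖f‖ ^ 2) (x : Icc (0 : ℝ) 1) :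
    ‖primitive (dirichletPrimitive.adjoint (g - mulOp Q f)) x‖ ^ 2 ≤
      2 * √(Λ + ‖Q‖) * ‖f‖ ^ 2 := by
  set d := dirichletPrimitive.adjoint (g - mulOp Q f) with hd
  have hdf : ‖d‖ ≤ √(Λ + ‖Q‖) * ‖f‖ := by
    refine le_of_sq_le_sq ?_ (by positivity)
    have hQf : |RCLike.re ⟪mulOp Q f, f⟫_ℂ| ≤ ‖Q‖ * ‖f‖ ^ 2 := by
      calc |RCLike.re ⟪mulOp Q f, f⟫_ℂ| ≤ ‖mulOp Q f‖ * ‖f‖ :=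
            (RCLike.abs_re_le_norm _).trans (norm_inner_le_norm _ _)
        _ ≤ ‖Q‖ * ‖f‖ * ‖f‖ := by gcongr; exact (mulOp Q).le_of_opNorm_le (norm_mulOp_le Q) f
        _ = ‖Q‖ * ‖f‖ ^ 2 := by ring
    rw [mul_pow, Real.sq_sqrt (by positivity), hd, h.norm_adjoint_dirichletPrimitive_sq hQ,
      inner_sub_left, map_sub, add_mul]
    linarith [neg_le_abs (RCLike.re ⟪mulOp Q f, f⟫_ℂ)]
  calc ‖primitive d x‖ ^ 2 ≤ 2 * (‖d‖ * ‖volterra d‖) := norm_primitive_apply_sq_le d x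
    _ = 2 * (‖d‖ * ‖f‖) := by rw [volterra_apply, h.toL2_primitive hQ]
    _ ≤ 2 * (√(Λ + ‖Q‖) * ‖f‖ * ‖f‖) := by gcongr
    _ = 2 * √(Λ + ‖Q‖) * ‖f‖ ^ 2 := by ring

theorem IsDirichletSL.sum (hQ : Q =ᵐ[mu] q) {ι : Type*} {s : Finset ι} {F G : ι → L2}
    (h : ∀ i ∈ s, IsDirichletSL q (F i) (G i)) :
    IsDirichletSL q (∑ i ∈ s, F i) (∑ i ∈ s, G i) := by
  rw [isDirichletSL_iff hQ, map_sum (mulOp Q), ← Finset.sum_sub_distrib, map_sum, map_sum]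
  exact Finset.sum_congr rfl fun i hi => (isDirichletSL_iff hQ).1 (h i hi)

/-- The values at both endpoints of a continuous function on `[0,1]`. -/
def endpointValues : BoundedContinuousFunction (Icc (0 : ℝ) 1) ℂ →L[ℂ] ℂ × ℂ :=
  (BoundedContinuousFunction.evalCLM ℂ 0).prod (BoundedContinuousFunction.evalCLM ℂ 1)

theorem endpointValues_primitive_adjoint (h : L2) :
    endpointValues (primitive (dirichletPrimitive.adjoint h)) = 0 :=
  Prod.ext (primitive_apply_zero _)
    ((inner_oneL2 _).symm.trans (inner_oneL2_adjoint_dirichletPrimitive h))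

theorem vanishesAtEndpoints_toL2 {G : BoundedContinuousFunction (Icc (0 : ℝ) 1) ℂ}
    (hG : endpointValues G = 0) : VanishesAtEndpoints (toL2 G) := by
  refine ⟨_, G.continuous.Icc_extend'.continuousOn, coeFn_toL2 G, ?_, ?_⟩
  · rw [IccExtend_left]
    exact congrArg Prod.fst hG
  · rw [IccExtend_right]
    exact congrArg Prod.snd hG

theorem norm_sum_primitive_le (hQ : Q =ᵐ[mu] q) {ι : Type*} {v : ι → L2} {lam : ι → ℝ}
    (hv : Orthonormal ℂ v) (h : ∀ i, IsDirichletSL q (v i) ((lam i : ℂ) • v i)) {s : Finset ι}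
    {Λ : ℝ} (hΛ : 0 ≤ Λ) (hs : ∀ i ∈ s, lam i ≤ Λ) (a : ι → ℂ) :
    ‖∑ i ∈ s, a i • primitive (dirichletPrimitive.adjoint ((lam i : ℂ) • v i - mulOp Q (v i)))‖ ≤
      √(2 * √(Λ + ‖Q‖)) * ‖∑ i ∈ s, a i • v i‖ := by
  have hsum := IsDirichletSL.sum hQ (s := s) fun i _ => (h i).smul hQ (a i)
  have heq : ∑ i ∈ s, a i • primitive (dirichletPrimitive.adjoint
      ((lam i : ℂ) • v i - mulOp Q (v i))) = primitive (dirichletPrimitive.adjoint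
      (∑ i ∈ s, a i • (lam i : ℂ) • v i - mulOp Q (∑ i ∈ s, a i • v i))) := by
    simp only [map_sub, map_sum, map_smul, smul_sub, Finset.sum_sub_distrib]
  refine (BoundedContinuousFunction.norm_le (by positivity)).2 fun x => ?_
  refine le_of_sq_le_sq ?_ (by positivity)
  rw [heq, mul_pow, Real.sq_sqrt (by positivity)]
  exact hsum.norm_primitive_sq_le hQ hΛ (re_inner_sum_smul_le hv hs a) x

theorem vanishesAtEndpoints_of_inner_eq (hQ : Q =ᵐ[mu] q) {ι : Type*} {b : HilbertBasis ι ℂ L2}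
    {lam : ι → ℝ} (hb : ∀ i, IsEigenpair q (lam i) (b i)) (hfin : ∀ Λ, {i | lam i ≤ Λ}.Finite)
    {δ : ℝ} (hδ : 0 < δ) (hlam : ∀ i, δ ≤ lam i) {r : ℝ} (hr : 1 / 4 < r) {u w : L2}
    (huw : ∀ i, ⟪b i, w⟫_ℂ = ((lam i ^ r : ℝ) : ℂ) * ⟪b i, u⟫_ℂ) : VanishesAtEndpoints u := by
  let e (i : ι) := primitive (dirichletPrimitive.adjoint ((lam i : ℂ) • b i - mulOp Q (b i)))
  have hX (s : Finset ι) (R : ℝ) (hR : 1 ≤ R) (hs : ∀ i ∈ s, lam i / δ ≤ R) (a : ι → ℂ) :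
      ‖∑ i ∈ s, a i • e i‖ ≤
        √(2 * √(δ + ‖Q‖)) * R ^ (1 / 4 : ℝ) * ‖∑ i ∈ s, a i • b i‖ := by
    have hR₀ : 0 ≤ R := zero_le_one.trans hR
    refine (norm_sum_primitive_le hQ b.orthonormal (fun i => (hb i).2) (mul_nonneg hR₀ hδ.le)
      (fun i hi => (div_le_iff₀ hδ).1 (hs i hi)) a).trans ?_
    have hroot : R ^ (1 / 4 : ℝ) = √√R := by
      rw [Real.sqrt_eq_rpow, Real.sqrt_eq_rpow, ← Real.rpow_mul hR₀]; norm_num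
    rw [hroot, ← Real.sqrt_mul (by positivity), mul_assoc, ← Real.sqrt_mul (by positivity)]
    gcongr
    linarith [le_mul_of_one_le_right (norm_nonneg Q) hR]
  have hcoeff (i : ι) : (lam i / δ) ^ r * ‖⟪b i, u⟫_ℂ‖ ≤ ‖⟪b i, ((δ ^ r : ℝ) : ℂ)⁻¹ • w⟫_ℂ‖ := by
    have hlam₀ : 0 ≤ lam i := hδ.le.trans (hlam i)
    rw [inner_smul_right, huw, norm_mul, norm_mul, norm_inv, Complex.norm_real, Complex.norm_real,
      Real.norm_of_nonneg (by positivity), Real.norm_of_nonneg (by positivity), ← mul_assoc,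
      ← div_eq_inv_mul, Real.div_rpow hlam₀ hδ.le]
  obtain ⟨G, hG, rfl⟩ := exists_mem_closure_span_apply_eq b toL2
    (fun i => (hb i).2.toL2_primitive hQ) (fun i => (one_le_div hδ).2 (hlam i))
    (fun R => (hfin (R * δ)).subset fun i hi => (div_le_iff₀ hδ).1 hi) (by positivity)
    (by linarith) hr hX hcoeff
  refine vanishesAtEndpoints_toL2 (Submodule.topologicalClosure_minimal _
    (Submodule.span_le.2 ?_) endpointValues.isClosed_ker hG)
  rintro _ ⟨i, rfl⟩
  exact endpointValues_primitive_adjoint _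

end Endpoints

section Solutions

variable {q : ℝ → ℝ} {Q : LInf} {ι : Type*} {b : HilbertBasis ι ℂ L2} {lam : ι → ℝ} {δ s T : ℝ}

theorem IsFracPow.norm_le (hQ : Q =ᵐ[mu] q) (hb : ∀ i, IsEigenpair q (lam i) (b i))
    (hδ : 0 < δ) (hlam : ∀ i, δ ≤ lam i) {r : ℝ} (hr : 0 ≤ r) {f g : L2}
    (h : IsFracPow q r f g) : ‖f‖ ≤ (δ ^ r)⁻¹ * ‖g‖ := by
  refine norm_le_mul_of_forall_norm_inner_le b (by positivity) fun i => ?_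
  rw [(isFracPow_iff hQ hb).1 h i, norm_mul, Complex.norm_real, ← div_eq_inv_mul,
    le_div_iff₀' (by positivity)]
  gcongr
  exact (Real.rpow_le_rpow hδ.le (hlam i) hr).trans (Real.le_norm_self _)

variable {A B : L2 →L[ℂ] L2} {α β : LInf} {u v w : ℝ → L2}

theorem IsDampedWave.isInSolutionSpace (hQ : Q =ᵐ[mu] q)
    (hb : ∀ i, IsEigenpair q (lam i) (b i))
    (h : IsDampedWave b (fun i => lam i ^ (s / 2)) A B T u v w) : IsInSolutionSpace T q s u v w :=
  ⟨h.hasDerivWithinAt, h.continuous_v.continuousOn,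
    fun t _ => (isFracPow_iff hQ hb).2 (h.inner_w t), h.continuous_w.continuousOn⟩

theorem IsDampedWave.isSolution (hQ : Q =ᵐ[mu] q) (hb : ∀ i, IsEigenpair q (lam i) (b i))
    (hfin : ∀ Λ, {i | lam i ≤ Λ}.Finite) (hδ : 0 < δ) (hlam : ∀ i, δ ≤ lam i)
    (h : IsDampedWave b (fun i => lam i ^ (s / 2)) (mulOp α) (mulOp β) T u v w) :
    IsSolution T q s α β (u 0) (v 0) u :=
  ⟨v, w, h.isInSolutionSpace hQ hb,
    fun f g hfg => h.hasDerivWithinAt_inner f g ((isFracPow_iff hQ hb).1 hfg), rfl, rfl,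
    fun hs t _ => vanishesAtEndpoints_of_inner_eq hQ hb hfin hδ hlam (by linarith) (h.inner_w t)⟩

theorem add_le_of_energy_le {x y z x₀ y₀ a c : ℝ} (hc : 0 ≤ c) (ha : 0 ≤ a) (hy : 0 ≤ y)
    (hz : z ≤ c * x) (h : x ^ 2 + y ^ 2 ≤ x₀ ^ 2 + y₀ ^ 2 + a * (c * x₀) ^ 2) :
    z + x + y ≤ (1 + c) * (1 + c ^ 2) * (1 + (x₀ ^ 2 + y₀ ^ 2 + a * x₀ ^ 2)) := by
  have hx₀ : 0 ≤ a * x₀ ^ 2 := by positivity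
  have hcx₀ : 0 ≤ c ^ 2 * (1 + (x₀ ^ 2 + y₀ ^ 2)) := by positivity
  calc z + x + y ≤ (1 + c) * (x + y) := by linarith [mul_nonneg hc hy]
    _ ≤ (1 + c) * (1 + (x ^ 2 + y ^ 2)) := by
        refine mul_le_mul_of_nonneg_left ?_ (by positivity)
        linarith [sq_nonneg (x - 1), sq_nonneg (y - 1), sq_nonneg x, sq_nonneg y]
    _ ≤ (1 + c) * ((1 + c ^ 2) * (1 + (x₀ ^ 2 + y₀ ^ 2 + a * x₀ ^ 2))) := by
        refine mul_le_mul_of_nonneg_left ?_ (by positivity)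
        linarith
    _ = _ := (mul_assoc _ _ _).symm

theorem exists_isSolution_norm_le (hq : MemLp q ∞ mu)
    (hpos : ∀ (lam : ℝ) (phi : L2), IsEigenpair q lam phi → 0 < lam) (hs : 0 ≤ s) (hT : 0 ≤ T) :
    ∃ K, 0 < K ∧ ∀ (α β : LInf) (u₀ w₀ u₁ : L2), 0 ≤ α → 0 ≤ β → IsFracPow q (s / 2) u₀ w₀ →
      ∃ u v w : ℝ → L2, IsSolution T q s α β u₀ u₁ u ∧ IsInSolutionSpace T q s u v w ∧
        ∀ t ∈ Icc 0 T, ‖u t‖ + ‖w t‖ + ‖v t‖ ≤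
          K * (1 + (‖w₀‖ ^ 2 + ‖u₁‖ ^ 2 + ‖α‖ * ‖w₀‖ ^ 2)) := by
  have hQ : hq.toLp q =ᵐ[mu] q := hq.coeFn_toLp
  obtain ⟨ι, b, lam, hb, hfin⟩ := exists_hilbertBasis_isEigenpair hQ
  obtain ⟨δ, hδ, hlam⟩ := exists_pos_forall_le (fun i => hpos _ _ (hb i)) hfin
  have hs₂ : 0 ≤ s / 2 := by positivity
  let c := (δ ^ (s / 2))⁻¹
  have hnorm {f g : L2} (h : IsFracPow q (s / 2) f g) : ‖f‖ ≤ c * ‖g‖ :=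
    h.norm_le hQ hb hδ hlam hs₂
  refine ⟨(1 + c) * (1 + c ^ 2), by positivity, fun α β u₀ w₀ u₁ hα hβ h₀ => ?_⟩
  obtain ⟨u, v, w, h, rfl, rfl, rfl⟩ := exists_isDampedWave (Real.rpow_pos_of_pos hδ (s / 2))
    (fun i => Real.rpow_le_rpow hδ.le (hlam i) hs₂) (mulOp α) (mulOp β) hT
    ((isFracPow_iff hQ hb).1 h₀) u₁
  have hspace := h.isInSolutionSpace hQ hb
  refine ⟨u, v, w, h.isSolution hQ hb hfin hδ hlam, hspace, fun t ht => ?_⟩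
  refine add_le_of_energy_le (by positivity) (norm_nonneg α) (norm_nonneg _)
    (hnorm (hspace.frac t ht)) ?_
  refine (h.energy_le (isPositive_mulOp hα)
    (fun x => (isPositive_mulOp hβ).re_inner_nonneg_right x) ht).trans ?_
  gcongr
  · exact norm_mulOp_le α
  · exact hnorm h₀

end Solutions

section Moderateness

variable {m n : ℝ → ℝ}

theorem inv_pow_le_inv_pow {ε : ℝ} (hε : ε ∈ Ioc (0 : ℝ) 1) {M N : ℕ} (h : M ≤ N) :
    (ε ^ M)⁻¹ ≤ (ε ^ N)⁻¹ :=
  inv_anti₀ (pow_pos hε.1 _) (pow_le_pow_of_le_one hε.1.le hε.2 h)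

theorem isModerate_const {c : ℝ} (hc : 0 < c) : IsModerate fun _ => c :=
  ⟨0, c, hc, fun ε _ => by rw [pow_zero, inv_one, mul_one]⟩

theorem IsModerate.add (hm : IsModerate m) (hn : IsModerate n) :
    IsModerate fun ε => m ε + n ε := by
  obtain ⟨M, C, hC, hmC⟩ := hm
  obtain ⟨N, D, hD, hnD⟩ := hn
  refine ⟨M + N, C + D, add_pos hC hD, fun ε hε => ?_⟩
  rw [add_mul]
  refine add_le_add ((hmC ε hε).trans ?_) ((hnD ε hε).trans ?_)
  · exact mul_le_mul_of_nonneg_left (inv_pow_le_inv_pow hε (Nat.le_add_right M N)) hC.le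
  · exact mul_le_mul_of_nonneg_left (inv_pow_le_inv_pow hε (Nat.le_add_left N M)) hD.le

theorem IsModerate.mul (hm : IsModerate m) (hn : IsModerate n) (hn₀ : ∀ ε, 0 ≤ n ε) :
    IsModerate fun ε => m ε * n ε := by
  obtain ⟨M, C, hC, hmC⟩ := hm
  obtain ⟨N, D, hD, hnD⟩ := hn
  refine ⟨M + N, C * D, mul_pos hC hD, fun ε hε => ?_⟩
  have hε₀ : 0 < ε := hε.1
  calc m ε * n ε ≤ (C * (ε ^ M)⁻¹) * (D * (ε ^ N)⁻¹) :=
        mul_le_mul (hmC ε hε) (hnD ε hε) (hn₀ ε) (by positivity)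
    _ = C * D * (ε ^ (M + N))⁻¹ := by rw [pow_add, mul_inv, mul_mul_mul_comm]

theorem IsModerate.pow_two (hm : IsModerate m) (hm₀ : ∀ ε, 0 ≤ m ε) :
    IsModerate fun ε => m ε ^ 2 := by
  simpa only [sq] using hm.mul hm hm₀

theorem exists_isModerateSolutionNet {q : ℝ → ℝ} (hq : MemLp q ∞ mu)
    (hpos : ∀ (lam : ℝ) (phi : L2), IsEigenpair q lam phi → 0 < lam) {s T : ℝ} (hs : 0 ≤ s)
    (hT : 0 ≤ T) {α β : ℝ → LInf} {u₀ u₁ : ℝ → L2} (hα : ∀ ε ∈ Ioc (0 : ℝ) 1, 0 ≤ α ε)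
    (hα_mod : IsModerate fun ε => ‖α ε‖) (hβ : ∀ ε ∈ Ioc (0 : ℝ) 1, 0 ≤ β ε)
    (hu₀ : IsSobolevModerate q s u₀) (hu₁ : IsModerate fun ε => ‖u₁ ε‖) :
    ∃ u, IsModerateSolutionNet T q s α β u₀ u₁ u := by
  obtain ⟨K, hK, hsolve⟩ := exists_isSolution_norm_le hq hpos hs hT
  obtain ⟨w₀, hw₀, hw₀_mod⟩ := hu₀
  choose! u v w hu hspace hbound using fun ε (hε : ε ∈ Ioc (0 : ℝ) 1) =>
    hsolve (α ε) (β ε) (u₀ ε) (w₀ ε) (u₁ ε) (hα ε hε) (hβ ε hε) (hw₀ ε hε)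
  have hw₀_sq := hw₀_mod.pow_two fun ε => norm_nonneg _
  have hu₁_sq := hu₁.pow_two fun ε => norm_nonneg _
  have henergy := (hw₀_sq.add hu₁_sq).add (hα_mod.mul hw₀_sq fun ε => by positivity)
  obtain ⟨N, C, hC, hNC⟩ := (isModerate_const hK).mul ((isModerate_const one_pos).add henergy)
    fun ε => by positivity
  exact ⟨u, hu, v, w, hspace, N, C, hC, fun ε hε t ht => (hbound ε hε t ht).trans (hNC ε hε)⟩

end Moderateness

end SturmLiouville

end

theorem mainTheorem5 (T : ℝ) (hT : 0 < T) (s : ℝ) (hs : 0 ≤ s)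
    (q : ℝ → ℝ) (hq : MemLp q ∞ SturmLiouville.mu)
    (hpos : ∀ (lam : ℝ) (phi : SturmLiouville.L2),
      SturmLiouville.IsEigenpair q lam phi → 0 < lam)
    (a b : 𝓓'(SturmLiouville.unitOpen, ℝ)) (u0 u1 : 𝓓'(SturmLiouville.unitOpen, ℂ))
    (ha : SturmLiouville.IsNonnegDistribution a) (hb : SturmLiouville.IsNonnegDistribution b)
    (aE bE : ℝ → SturmLiouville.LInf) (u0E u1E : ℝ → SturmLiouville.L2)
    (hreg : SturmLiouville.ModerateRegularisations q s a b u0 u1 aE bE u0E u1E) :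
    ∃ u : ℝ → ℝ → SturmLiouville.L2,
      SturmLiouville.IsModerateSolutionNet T q s aE bE u0E u1E u ∧
      SturmLiouville.IsVeryWeakSolution T q s a b u0 u1 u := by
  obtain ⟨u, hu⟩ := SturmLiouville.exists_isModerateSolutionNet hq hpos hs hT.le hreg.a_nonneg
    hreg.a_moderate hreg.b_nonneg hreg.u0_moderate hreg.u1_moderate
  exact ⟨u, hu, aE, bE, u0E, u1E, hreg, hu⟩
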